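/- **Proposition.** Let $T\ge 1$, let $\mu:[0,T]\times\mathbb R^d\to\mathbb R^d$, $\sigma:[0,T]\times\mathbb R^d\to\mathbb R^{d\times d}$, $g:[0,T]\times\mathbb R^d\to\mathbb R^{o}$ and $f:\mathbb R^d\to\mathbb R^{o}$ be measurable, and let $W$ be a standard $\mathbb R^d$-valued Wiener process for a filtration on a probability space $(\Omega,\mathcal F_0,\mathbb P)$. For $N\in\{1,2,\dots\}$ put $t_n=nT/N$ and, for $s\in[0,T]$, $\lfloor s\rfloor=t_n$ if $s\in[t_n,t_{n+1})$. For $x\in\mathbb R^d$ let $\mathcal E^N(x)$ be the Euler scheme $$\mathcal E^N(x)_t=x+\int_0^t\mu\big(\lfloor s\rfloor,\mathcal E^N(x)_{\lfloor s\rfloor}\big)\,ds+\int_0^t\sigma\big(\lfloor s\rfloor,\mathcal E^N(x)_{\lfloor s\rfloor}\big)\,dW_s,\qquad 0\le t\le T .$$ For $M\in\{1,2,\dots\}$ let $\mathcal E_1(x),\dots,\mathcal E_M(x)$ be, for every $x\in\mathbb R^d$, independent copies of $\mathcal E^N(x)$ on $\Omega$, such that for each $m$ and each $t\in[0,T]$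 the map $(\omega,x)\mapsto\mathcal E_m(x)_t(\omega)$ is jointly measurable (up to null sets). Define $$v(x)=\mathbb E\Big[f\big(\mathcal E^N(x)_T\big)+\frac TN\sum_{n=0}^{N-1}g\big(t_n,\mathcal E^N(x)_{t_n}\big)\Big],\qquad \phi(x)=\frac1M\sum_{m=1}^M\Big[f\big(\mathcal E_m(x)_T\big)+\frac TN\sum_{n=0}^{N-1}g\big(t_n,\mathcal E_m(x)_{t_n}\big)\Big].$$ For $r\ge 0$ let $[h]_r=\sup_{x\in\mathbb R^d}\frac{\|h(x)\|}{(1+\|x\|)^r}\in[0,\infty]$ for a function $h$ on $\mathbb R^d$, and $[h]_r=\sup_{t\in[0,T]}[h(t,\cdot)]_r$ for a function $h$ on $[0,T]\times\mathbb R^d$, where matrices carry the Frobenius norm. Put $$c=\max\{[\mu]_1,[\sigma]_1^2\},\qquad C_r=\max\{[f]_r,[g]_r\}.$$ Then for every $r\in[1,\infty)$ there is a constant $\kappa_r>0$, depending only on $r$, such that for all data as above (in all dimensions $d,o$), all $\delta,\epsilon\in(0,1)$ and all compact $K\subseteq\mathbb R^d$ the following holds. If $N\ge 16cT$ (in particular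 $c<\infty$) and $$\epsilon\sqrt{\delta M}\ \ge\ \kappa_r\,C_r\,\sqrt{(1+c)T^3}\;e^{\kappa_r cT}\,\big\|1+\|x\|^r\big\|_{L^2(K)}$$ (a product in $[0,\infty]$ with $\infty\cdot 0=0$), then the expectation defining $v(x)$ exists for almost every $x\in K$, and $$\mathbb P\big(\|v-\phi\|_{L^2(K)}\le\epsilon\big)\ \ge\ 1-\delta .$$ -/

import Mathlib

open MeasureTheory ProbabilityTheory
open scoped NNReal ENNReal

/-- Euclidean space `ℝ^d`. -/
abbrev Euc (d : ℕ) : Type := EuclideanSpace ℝ (Fin d)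

namespace MCEuler

noncomputable section

/-- The growth measure of a function `h` on `ℝ^d`: the supremum over `x` of
`‖h x‖ / (1 + ‖x‖)^r`, as an element of `[0, ∞]`. -/
def growth {d : ℕ} {F : Type*} [NormedAddCommGroup F] (r : ℝ) (h : Euc d → F) : ℝ≥0∞ :=
  ⨆ x : Euc d, ‖h x‖ₑ / ENNReal.ofReal ((1 + ‖x‖) ^ r)

/-- The growth measure of a time-dependent function on `[0,T] × ℝ^d`: the supremum over
`t ∈ [0,T]` of the growth measures of `h t`. -/
def growthTime {d : ℕ} {F : Type*} [NormedAddCommGroup F] (T : ℝ≥0) (r : ℝ)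
    (h : ℝ≥0 → Euc d → F) : ℝ≥0∞ :=
  ⨆ t : Set.Iic T, growth r (h t)

section Frobenius

attribute [local instance] Matrix.frobeniusNormedAddCommGroup

/-- `c = max {[μ], [σ]^2}`, where `[h]` is the linear (`r = 1`) growth measure and matrices carry
the Frobenius norm. -/
def coeffGrowth {d : ℕ} (T : ℝ≥0) (μ : ℝ≥0 → Euc d → Euc d)
    (σ : ℝ≥0 → Euc d → Matrix (Fin d) (Fin d) ℝ) : ℝ≥0∞ :=
  max (growthTime T 1 μ) (growthTime T 1 σ ^ 2)

end Frobenius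

/-- `C_r`, the maximum of the order-`r` growth measures of `f` and `g`. -/
def dataGrowth {d o : ℕ} (T : ℝ≥0) (r : ℝ) (f : Euc d → Euc o) (g : ℝ≥0 → Euc d → Euc o) :
    ℝ≥0∞ :=
  max (growth r f) (growthTime T r g)

/-- A function on `[0,T] × ℝ^d`, given as a function of all times `t ≥ 0` whose values at `t > T`
are irrelevant, is jointly measurable. -/
def MeasurableUpTo {d : ℕ} {F : Type*} [MeasurableSpace F] (T : ℝ≥0)
    (h : ℝ≥0 → Euc d → F) : Prop :=
  Measurable fun p : Set.Iic T × Euc d => h p.1 p.2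

/-- `W` is a standard `ℝ^d`-valued Wiener process for the filtration `ℱ`. -/
structure IsWiener {d : ℕ} {Ω : Type*} {mΩ : MeasurableSpace Ω} (ℱ : Filtration ℝ≥0 mΩ)
    (W : ℝ≥0 → Ω → Euc d) (P : Measure Ω) : Prop where
  adapted : ∀ t, Measurable[ℱ t] (W t)
  start_zero : ∀ᵐ ω ∂P, W 0 ω = 0
  indep_increment : ∀ s t, s ≤ t →
    Indep (MeasurableSpace.comap (fun ω => W t ω - W s ω) inferInstance) (ℱ s) P
  law_increment : ∀ s t, s ≤ t →
    P.map (fun ω => W t ω - W s ω) =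
      (stdGaussian (Euc d)).map (fun z => Real.sqrt (t - s) • z)
  continuous_paths : ∀ᵐ ω ∂P, Continuous fun t => W t ω

/-- The grid point `t_n = n T / N`. -/
def gridPoint (T : ℝ≥0) (N n : ℕ) : ℝ≥0 := n * T / N

/-- The values at the grid points `t_0, t_1, …` of the Euler scheme started in `x` and driven by
the path `w`. -/
def eulerGrid {d : ℕ} (T : ℝ≥0) (N : ℕ) (μ : ℝ≥0 → Euc d → Euc d)
    (σ : ℝ≥0 → Euc d → Matrix (Fin d) (Fin d) ℝ) (w : ℝ≥0 → Euc d) (x : Euc d) : ℕ → Euc d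
  | 0 => x
  | n + 1 =>
    eulerGrid T N μ σ w x n
      + ((gridPoint T N (n + 1) : ℝ) - gridPoint T N n) •
          μ (gridPoint T N n) (eulerGrid T N μ σ w x n)
      + (σ (gridPoint T N n) (eulerGrid T N μ σ w x n)).toEuclideanLin
          (w (gridPoint T N (n + 1)) - w (gridPoint T N n))

/-- The Euler scheme as a process in continuous time,
`E_t = x + ∫_0^t μ(⌊s⌋, E_⌊s⌋) ds + ∫_0^t σ(⌊s⌋, E_⌊s⌋) dW_s` for `0 ≤ t ≤ T`.
Both integrands are constant on each `[t_n, t_{n+1})`, so that the two integrals are the finite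
sums below (the second is the Itô integral of a simple process). -/
def euler {d : ℕ} (T : ℝ≥0) (N : ℕ) (μ : ℝ≥0 → Euc d → Euc d)
    (σ : ℝ≥0 → Euc d → Matrix (Fin d) (Fin d) ℝ) (w : ℝ≥0 → Euc d) (x : Euc d) (t : ℝ≥0) :
    Euc d :=
  x + ∑ n ∈ Finset.range N,
    (((min t (gridPoint T N (n + 1)) : ℝ≥0) - (min t (gridPoint T N n) : ℝ≥0) : ℝ) •
        μ (gridPoint T N n) (eulerGrid T N μ σ w x n)
      + (σ (gridPoint T N n) (eulerGrid T N μ σ w x n)).toEuclideanLin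
        (w (min t (gridPoint T N (n + 1))) - w (min t (gridPoint T N n))))

/-- The functional `f(y_T) + (T / N) ∑_{n < N} g(t_n, y_{t_n})` of a path `y`. -/
def payoff {d o : ℕ} (T : ℝ≥0) (N : ℕ) (f : Euc d → Euc o) (g : ℝ≥0 → Euc d → Euc o)
    (y : ℝ≥0 → Euc d) : Euc o :=
  f (y T) + ((T : ℝ) / N) • ∑ n ∈ Finset.range N, g (gridPoint T N n) (y (gridPoint T N n))

/-- `X 1 x, …, X M x` are, for every `x`, independent copies (as processes on `[0,T]`) of the
Euler scheme started in `x`, and for each time the random field `(ω, x) ↦ X m x t ω` is jointly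
measurable (up to null sets), so that `x`-integrals of functions of it are random variables. -/
structure IsIndepEulerCopies {d M : ℕ} {Ω : Type*} [MeasurableSpace Ω] (P : Measure Ω)
    (T : ℝ≥0) (N : ℕ) (μ : ℝ≥0 → Euc d → Euc d)
    (σ : ℝ≥0 → Euc d → Matrix (Fin d) (Fin d) ℝ) (W : ℝ≥0 → Ω → Euc d)
    (X : Fin M → Euc d → ℝ≥0 → Ω → Euc d) : Prop where
  identDistrib : ∀ m x, IdentDistrib
    (fun ω (t : Set.Iic T) => X m x t ω)
    (fun ω (t : Set.Iic T) => euler T N μ σ (fun s => W s ω) x t) P P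
  indep : ∀ x, iIndepFun (fun m ω (t : Set.Iic T) => X m x t ω) P
  jointly_measurable : ∀ m, ∀ t ≤ T,
    AEMeasurable (fun p : Ω × Euc d => X m p.2 t p.1) (P.prod volume)

/-- `v(x)`, the expectation of the functional of the Euler scheme started in `x`. -/
def expectedPayoff {d o : ℕ} {Ω : Type*} [MeasurableSpace Ω] (P : Measure Ω) (T : ℝ≥0) (N : ℕ)
    (μ : ℝ≥0 → Euc d → Euc d) (σ : ℝ≥0 → Euc d → Matrix (Fin d) (Fin d) ℝ)
    (W : ℝ≥0 → Ω → Euc d) (f : Euc d → Euc o) (g : ℝ≥0 → Euc d → Euc o) (x : Euc d) : Euc o :=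
  ∫ ω, payoff T N f g (euler T N μ σ (fun s => W s ω) x) ∂P

/-- `φ(ω, x)`, the Monte Carlo average of the functional over the `M` copies. -/
def mcAverage {d o M : ℕ} {Ω : Type*} (T : ℝ≥0) (N : ℕ) (f : Euc d → Euc o)
    (g : ℝ≥0 → Euc d → Euc o) (X : Fin M → Euc d → ℝ≥0 → Ω → Euc d) (ω : Ω) (x : Euc d) :
    Euc o :=
  (1 / (M : ℝ)) • ∑ m : Fin M, payoff T N f g (fun t => X m x t ω)

end

end MCEuler

/-! At a fixed starting point `x` the Monte Carlo average is unbiased and its summands are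
independent, so its mean square error is at most `1 / M` times the second moment of one payoff.
Integrating over `K`, exchanging the integrals by Tonelli and applying Chebyshev's inequality
reduces the theorem to an `L²(P)` bound for the payoff that is of order `(1 + ‖x‖)^r` and
independent of the dimension. The growth hypotheses on `f` and `g` reduce this to moments of the
Euler scheme on the grid.

For these moments let `k = ⌈r⌉` and `h = T / N`. Given the past, one Euler step adds a small drift
`w` and an independent centred Gaussian `y`. Expanding `(1 + ‖x + w + y‖²)^k` to second order, the
term linear in `y` integrates to zero and everything else is `O(c h)` relative to `(1 + ‖x‖²)^k`;
here `N ≥ 16 c T` gives `c h ≤ 1 / 16`, so that higher powers of `c h` are absorbed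
(`lintegral_euler_step_le`). Iterating through the Markov property gives a factor `(1 + B c h)^N ≤
exp (B c T)` (`lintegral_eulerGrid_le`).

No dimension enters because `‖A z‖²` is a sum of squares of one-dimensional Gaussians whose
variances add up to the squared Frobenius norm of `A`; Minkowski's inequality in `L^p` then bounds
its norm by that of one squared standard normal. -/

namespace MCEuler

/-! ### Dimension-free moments of Gaussian vectors -/

/-- The moment of order `2 p` of a standard normal random variable. -/
noncomputable def normalMoment (p : ℕ) : ℝ := ∫ x, x ^ (2 * p) ∂(gaussianReal 0 1)

lemma normalMoment_nonneg (p : ℕ) : 0 ≤ normalMoment p :=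
  integral_nonneg fun x => by rw [pow_mul]; positivity

lemma stdGaussian_map_inner {d : ℕ} (v : Euc d) :
    (stdGaussian (Euc d)).map (fun z => inner ℝ v z) = (gaussianReal 0 1).map (fun x => ‖v‖ * x) := by
  have h := IsGaussian.map_eq_gaussianReal (μ := stdGaussian (Euc d)) (innerSL ℝ v)
  rw [integral_strongDual_stdGaussian, variance_dual_stdGaussian] at h
  rw [gaussianReal_map_const_mul]
  simp only [innerSL_apply_norm] at h
  simp only [mul_zero, mul_one]
  convert h using 2
  · ext
    simp
  · ext
    exact (Real.coe_toNNReal _ (sq_nonneg _)).symm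

lemma memLp_sq_gaussianReal (p : ℕ) : MemLp (fun x : ℝ => x ^ 2) p (gaussianReal 0 1) := by
  have h : MemLp (id : ℝ → ℝ) (p * 2 : ℕ) (gaussianReal 0 1) :=
    memLp_id_gaussianReal' _ (ENNReal.natCast_ne_top _)
  rcases Nat.eq_zero_or_pos p with rfl | hp
  · simp only [Nat.cast_zero, memLp_zero_iff_aestronglyMeasurable]
    fun_prop
  have h2 := h.norm_rpow_div (q := 2)
  have e : (((p * 2 : ℕ) : ℝ≥0∞) / 2) = p := by
    push_cast
    exact ENNReal.mul_div_cancel_right (by simp) (by simp)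
  rw [e] at h2
  refine h2.congr_norm (by fun_prop) ?_
  filter_upwards with x
  simp

lemma eLpNorm_inner_sq {d : ℕ} (p : ℕ) (v : Euc d) :
    eLpNorm (fun z : Euc d => (inner ℝ v z) ^ 2) p (stdGaussian (Euc d)) =
      ENNReal.ofReal (‖v‖ ^ 2) * eLpNorm (fun x : ℝ => x ^ 2) p (gaussianReal 0 1) := by
  have h1 : eLpNorm (fun z : Euc d => (inner ℝ v z) ^ 2) p (stdGaussian (Euc d)) =
      eLpNorm (fun x : ℝ => x ^ 2) p ((stdGaussian (Euc d)).map (fun z => inner ℝ v z)) := by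
    rw [eLpNorm_map_measure (by fun_prop) (by fun_prop)]
    rfl
  rw [h1, stdGaussian_map_inner, eLpNorm_map_measure (by fun_prop) (by fun_prop)]
  have h2 : ((fun x : ℝ => x ^ 2) ∘ fun x => ‖v‖ * x) = (‖v‖ ^ 2) • (fun x : ℝ => x ^ 2) := by
    ext x
    simp [mul_pow]
  rw [h2, eLpNorm_const_smul, Real.enorm_of_nonneg (by positivity)]

lemma norm_sq_toEuclideanLin {d : ℕ} (A : Matrix (Fin d) (Fin d) ℝ) (z : Euc d) :
    ‖A.toEuclideanLin z‖ ^ 2 = ∑ i, (inner ℝ (WithLp.toLp 2 (A i) : Euc d) z) ^ 2 := by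
  rw [EuclideanSpace.real_norm_sq_eq]
  refine Finset.sum_congr rfl fun i _ => ?_
  simp [Matrix.toEuclideanLin, Matrix.mulVec, dotProduct, PiLp.inner_apply, mul_comm]

lemma continuous_toEuclideanLin {d : ℕ} (A : Matrix (Fin d) (Fin d) ℝ) :
    Continuous fun z : Euc d => A.toEuclideanLin z :=
  LinearMap.continuous_of_finiteDimensional _

/-- Minkowski's inequality applied to the squared coordinates: each coordinate is distributed as the
norm of a row of `A` times a standard normal. The dependence between coordinates plays no role, and
the squared row norms sum to the squared Frobenius norm. -/
lemma eLpNorm_norm_sq_toEuclideanLin_le {d : ℕ} (A : Matrix (Fin d) (Fin d) ℝ) {p : ℕ}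
    (hp : 1 ≤ p) :
    eLpNorm (fun z : Euc d => ‖A.toEuclideanLin z‖ ^ 2) p (stdGaussian (Euc d)) ≤
      ENNReal.ofReal (∑ i, ∑ j, A i j ^ 2) *
        eLpNorm (fun x : ℝ => x ^ 2) p (gaussianReal 0 1) := by
  have e : (fun z : Euc d => ‖A.toEuclideanLin z‖ ^ 2) =
      ∑ i, fun z : Euc d => (inner ℝ (WithLp.toLp 2 (A i) : Euc d) z) ^ 2 := by
    ext z
    rw [norm_sq_toEuclideanLin, Finset.sum_apply]
  rw [e]
  refine (eLpNorm_sum_le (fun i _ => by fun_prop) (by exact_mod_cast hp)).trans ?_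
  simp_rw [eLpNorm_inner_sq]
  rw [← Finset.sum_mul, ← ENNReal.ofReal_sum_of_nonneg (fun _ _ => by positivity)]
  simp [EuclideanSpace.real_norm_sq_eq]

/-- The `2 p`-th moment of a Gaussian vector `A z` is bounded by the `2 p`-th power of the
Frobenius norm of `A`, with a constant that does not depend on the dimension. -/
lemma integral_norm_toEuclideanLin_pow_le {d : ℕ} (A : Matrix (Fin d) (Fin d) ℝ) {p : ℕ}
    (hp : 1 ≤ p) :
    Integrable (fun z : Euc d => (‖A.toEuclideanLin z‖ ^ 2) ^ p) (stdGaussian (Euc d)) ∧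
    ∫ z : Euc d, (‖A.toEuclideanLin z‖ ^ 2) ^ p ∂(stdGaussian (Euc d)) ≤
      (∑ i, ∑ j, A i j ^ 2) ^ p * normalMoment p := by
  have hA := continuous_toEuclideanLin A
  have hS : 0 ≤ ∑ i, ∑ j, A i j ^ 2 := by positivity
  have key : ∫⁻ z : Euc d, ENNReal.ofReal ((‖A.toEuclideanLin z‖ ^ 2) ^ p) ∂(stdGaussian (Euc d)) ≤
      ENNReal.ofReal ((∑ i, ∑ j, A i j ^ 2) ^ p * normalMoment p) := by
    have h0 : ∀ {α : Type} [MeasurableSpace α] (m : Measure α) (u : α → ℝ), (∀ x, 0 ≤ u x) →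
        eLpNorm u p m ^ p = ∫⁻ x, ENNReal.ofReal (u x ^ p) ∂m := by
      intro α _ m u hu
      have := eLpNorm_nnreal_pow_eq_lintegral (μ := m) (f := u) (p := (p : ℝ≥0))
        (by exact_mod_cast (by omega : p ≠ 0))
      simp only [NNReal.coe_natCast, ENNReal.rpow_natCast, ENNReal.coe_natCast] at this
      rw [this]
      refine lintegral_congr fun x => ?_
      rw [Real.enorm_of_nonneg (hu x), ENNReal.ofReal_pow (hu x)]
    rw [← h0 _ _ (fun x => by positivity)]
    refine (pow_le_pow_left' (eLpNorm_norm_sq_toEuclideanLin_le A hp) p).trans ?_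
    rw [mul_pow, h0 _ _ (fun x => by positivity), ENNReal.ofReal_mul (by positivity),
      ENNReal.ofReal_pow hS, normalMoment, ofReal_integral_eq_lintegral_ofReal]
    · simp_rw [← pow_mul]; rfl
    · have := (memLp_sq_gaussianReal p).integrable_norm_pow (by omega)
      refine this.congr ?_
      filter_upwards with x
      simp [pow_mul]
    · filter_upwards with x
      rw [pow_mul]; positivity
  have hi : Integrable (fun z : Euc d => (‖A.toEuclideanLin z‖ ^ 2) ^ p) (stdGaussian (Euc d)) := by
    refine ⟨by fun_prop, ?_⟩
    rw [hasFiniteIntegral_iff_ofReal (by filter_upwards with x; positivity)]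
    exact key.trans_lt ENNReal.ofReal_lt_top
  refine ⟨hi, ?_⟩
  rw [← ofReal_integral_eq_lintegral_ofReal hi (by filter_upwards with x; positivity)] at key
  exact (ENNReal.ofReal_le_ofReal_iff (mul_nonneg (by positivity) (normalMoment_nonneg p))).1 key

/-! ### Second-order expansion of one Euler step -/

/-- By induction: the remainder for `k + 1` is `1 + u` times the remainder for `k`, plus `k * u ^
2`, and `k ^ 2 + (2 * k + 1) = (k + 1) ^ 2`. -/
lemma abs_one_add_pow_sub_le (u : ℝ) (k : ℕ) :
    |(1 + u) ^ k - 1 - k * u| ≤ k ^ 2 * (u ^ 2 * (1 + |u|) ^ k) := by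
  induction k with
  | zero => simp
  | succ k ih =>
    have e : (1 + u) ^ (k + 1) - 1 - ((k + 1 : ℕ) : ℝ) * u
        = (1 + u) * ((1 + u) ^ k - 1 - k * u) + k * u ^ 2 := by
      push_cast; ring
    rw [e]
    have h1 : |1 + u| ≤ 1 + |u| := (abs_add_le _ _).trans (by simp)
    have h2 : |(1 + u) * ((1 + u) ^ k - 1 - k * u)| ≤
        (1 + |u|) * (k ^ 2 * (u ^ 2 * (1 + |u|) ^ k)) := by
      rw [abs_mul]
      exact mul_le_mul h1 ih (abs_nonneg _) (by positivity)
    have h3 : |(k : ℝ) * u ^ 2| = k * u ^ 2 := abs_of_nonneg (by positivity)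
    have h4 : (1 : ℝ) ≤ (1 + |u|) ^ (k + 1) := one_le_pow₀ (by linarith [abs_nonneg u])
    have h5 : (k : ℝ) * u ^ 2 ≤ (2 * k + 1) * (u ^ 2 * (1 + |u|) ^ (k + 1)) := by
      have : u ^ 2 ≤ u ^ 2 * (1 + |u|) ^ (k + 1) := le_mul_of_one_le_right (by positivity) h4
      have hk : (0 : ℝ) ≤ k := by positivity
      nlinarith [sq_nonneg u]
    refine (abs_add_le _ _).trans ?_
    rw [h3]
    push_cast
    calc _ ≤ (1 + |u|) * (k ^ 2 * (u ^ 2 * (1 + |u|) ^ k))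
          + (2 * k + 1) * (u ^ 2 * (1 + |u|) ^ (k + 1)) := add_le_add h2 h5
      _ = _ := by ring

/-- The constant in the remainder estimate `remainder_le`. -/
def remainderConst (k : ℕ) : ℝ := 75 * 12 ^ k * 2 ^ k

/-- Here `s` is the size of the drift and `R` that of the noise, both relative. The right-hand side
is a combination of `s`, `R²` and higher powers of `R²`, each of which has Gaussian mean `O(s)`. The
constant collects `75 = 3 * 25` from squaring three terms, `1 + |u| ≤ 12 * (1 + R²)`, and `2 ^ k`
from convexity of the power. -/
lemma remainder_le {u s R : ℝ} (hs : 0 ≤ s) (hs' : s ≤ 1 / 16)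
    (hu : |u| ≤ 5 * s + 5 * R + R ^ 2) (k : ℕ) :
    u ^ 2 * (1 + |u|) ^ k ≤ remainderConst k * ((s + R ^ 2) * (1 + (R ^ 2) ^ (k + 1))) := by
  have h1 : u ^ 2 ≤ 75 * ((s + R ^ 2) * (1 + R ^ 2)) := by
    have : u ^ 2 ≤ (5 * s + 5 * R + R ^ 2) ^ 2 := by
      rw [← sq_abs]; exact pow_le_pow_left₀ (abs_nonneg _) hu 2
    have h3 : (5 * s + 5 * R + R ^ 2) ^ 2 ≤ 3 * (25 * s ^ 2 + 25 * R ^ 2 + (R ^ 2) ^ 2) := by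
      nlinarith [sq_nonneg (5 * s - 5 * R), sq_nonneg (5 * s - R ^ 2), sq_nonneg (5 * R - R ^ 2)]
    have h4 : s ^ 2 ≤ s := by nlinarith
    nlinarith [sq_nonneg (R ^ 2), sq_nonneg R, mul_nonneg hs (sq_nonneg R)]
  have h2 : (1 + |u|) ^ k ≤ 12 ^ k * (1 + R ^ 2) ^ k := by
    rw [← mul_pow]
    refine pow_le_pow_left₀ (by positivity) ?_ k
    nlinarith [sq_nonneg (R - 1)]
  have h3 : (1 + R ^ 2) ^ (k + 1) ≤ 2 ^ k * (1 + (R ^ 2) ^ (k + 1)) := by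
    have := add_pow_le (zero_le_one' ℝ) (sq_nonneg R) (k + 1)
    simpa using this
  calc _ ≤ 75 * ((s + R ^ 2) * (1 + R ^ 2)) * (12 ^ k * (1 + R ^ 2) ^ k) := by gcongr
    _ = 75 * 12 ^ k * ((s + R ^ 2) * (1 + R ^ 2) ^ (k + 1)) := by ring
    _ ≤ 75 * 12 ^ k * ((s + R ^ 2) * (2 ^ k * (1 + (R ^ 2) ^ (k + 1)))) := by gcongr
    _ = _ := by rw [remainderConst]; ring

/-- Expansion of `(1 + ‖x + w + y‖²)^k` to second order in a small drift `w` and a noise `y`. -/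
lemma one_add_norm_sq_pow_le {E : Type*} [NormedAddCommGroup E] [InnerProductSpace ℝ E]
    (x w y : E) {s : ℝ} (hs : 0 ≤ s) (hs' : s ≤ 1 / 16) (hw : ‖w‖ ≤ s * (1 + ‖x‖)) (k : ℕ) :
    (1 + ‖x + w + y‖ ^ 2) ^ k ≤ (1 + ‖x‖ ^ 2) ^ k *
      (1 + k * (5 * s + 2 * inner ℝ (x + w) y / (1 + ‖x‖ ^ 2) + ‖y‖ ^ 2 / (1 + ‖x‖ ^ 2))
        + k ^ 2 * (remainderConst k * ((s + ‖y‖ ^ 2 / (1 + ‖x‖ ^ 2)) *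
          (1 + (‖y‖ ^ 2 / (1 + ‖x‖ ^ 2)) ^ (k + 1))))) := by
  set a : ℝ := 1 + ‖x‖ ^ 2 with ha
  have ha0 : 0 < a := by positivity
  -- All sizes are measured relative to `ρ`, which dominates both `1` and `‖x‖`.
  set ρ := Real.sqrt a with hρ
  have hρ2 : ρ ^ 2 = a := Real.sq_sqrt ha0.le
  have hρ0 : 0 < ρ := Real.sqrt_pos.2 ha0
  have hx : ‖x‖ ≤ ρ := Real.le_sqrt_of_sq_le (by rw [ha]; linarith)
  have h1 : 1 ≤ ρ := Real.le_sqrt_of_sq_le (by rw [ha]; nlinarith [sq_nonneg ‖x‖])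
  have hw2 : ‖w‖ ≤ 2 * s * ρ := hw.trans (by nlinarith)
  set R := ‖y‖ / ρ with hR
  have hR0 : 0 ≤ R := by positivity
  have hyR : ‖y‖ = R * ρ := by rw [hR]; field_simp
  have hQ : ‖y‖ ^ 2 / a = R ^ 2 := by rw [hR, div_pow, hρ2]
  set α := (2 * inner ℝ x w + ‖w‖ ^ 2) / a with hα
  set β := 2 * inner ℝ (x + w) y / a with hβ
  have hα5 : |α| ≤ 5 * s := by
    rw [hα, abs_div, abs_of_pos ha0, div_le_iff₀ ha0, ← hρ2]
    have := abs_real_inner_le_norm x w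
    have hb : ‖x‖ * ‖w‖ ≤ ρ * (2 * s * ρ) := by gcongr
    have hc : ‖w‖ ^ 2 ≤ (2 * s * ρ) ^ 2 := by gcongr
    have hd : |2 * inner ℝ x w + ‖w‖ ^ 2| ≤ 2 * |inner ℝ x w| + ‖w‖ ^ 2 := by
      refine (abs_add_le _ _).trans ?_
      rw [abs_mul, abs_two, abs_of_nonneg (sq_nonneg ‖w‖)]
    have he : s * s * ρ ^ 2 ≤ s * (1 / 16) * ρ ^ 2 := by gcongr
    nlinarith
  have hβ5 : |β| ≤ 5 * R := by
    rw [hβ, abs_div, abs_of_pos ha0, div_le_iff₀ ha0, ← hρ2, abs_mul, abs_two]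
    have h3 := abs_real_inner_le_norm (x + w) y
    have h4 : ‖x + w‖ ≤ 2 * ρ := (norm_add_le _ _).trans (by nlinarith)
    have h5 : ‖x + w‖ * ‖y‖ ≤ 2 * ρ * (R * ρ) := by rw [← hyR]; gcongr
    have : 0 ≤ R * ρ ^ 2 := by positivity
    nlinarith
  set u := α + β + R ^ 2 with hu
  have hmain : 1 + ‖x + w + y‖ ^ 2 = a * (1 + u) := by
    have : a * u = 2 * inner ℝ x w + ‖w‖ ^ 2 + 2 * inner ℝ (x + w) y + ‖y‖ ^ 2 := by
      rw [hu, hα, hβ, ← hQ]; field_simp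
    rw [mul_add, this, norm_add_sq_real, norm_add_sq_real, ha]
    ring
  have hub : |u| ≤ 5 * s + 5 * R + R ^ 2 := by
    rw [hu]
    refine (abs_add_le _ _).trans ?_
    rw [abs_of_nonneg (sq_nonneg R)]
    linarith [abs_add_le α β]
  have hrem := remainder_le hs hs' hub k
  have hbin := (le_abs_self _).trans (abs_one_add_pow_sub_le u k)
  rw [hmain, mul_pow, hQ]
  refine mul_le_mul_of_nonneg_left ?_ (by positivity)
  have hk : (0 : ℝ) ≤ k := by positivity
  -- Only the drift part `α` is replaced by its bound; `β` keeps its sign, because it is linear in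
  -- `y` and has mean zero under the Gaussian law.
  have h6 : (k : ℝ) * u ≤ k * (5 * s + β + R ^ 2) := by
    refine mul_le_mul_of_nonneg_left ?_ hk
    rw [hu]
    linarith [le_abs_self α]
  have h7 := mul_le_mul_of_nonneg_left hrem (sq_nonneg (k : ℝ))
  linarith

/-- The growth rate per unit of time of the moment of order `2 k` of an Euler step. -/
noncomputable def stepRate (k : ℕ) : ℝ :=
  k * (5 + 2 * normalMoment 1) + k ^ 2 * (remainderConst k *
    (1 + 2 * normalMoment 1 + 2 * normalMoment (k + 1) + 2 * normalMoment (k + 2)))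

lemma stepRate_nonneg (k : ℕ) : 0 ≤ stepRate k := by
  have := normalMoment_nonneg 1
  have := normalMoment_nonneg (k + 1)
  have := normalMoment_nonneg (k + 2)
  rw [stepRate, remainderConst]
  positivity

/-- One step of the Euler scheme increases the moment of order `2 k` by at most the factor
`1 + stepRate k * (c * h)`. -/
lemma lintegral_euler_step_le (k : ℕ) {d : ℕ} (x b : Euc d) (A : Matrix (Fin d) (Fin d) ℝ)
    {h c : ℝ} (hh : 0 ≤ h) (hc : 0 ≤ c) (hch : c * h ≤ 1 / 16) (hb : ‖b‖ ≤ c * (1 + ‖x‖))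
    (hA : ∑ i, ∑ j, A i j ^ 2 ≤ c * (1 + ‖x‖) ^ 2) :
    ∫⁻ z : Euc d, ENNReal.ofReal ((1 + ‖x + h • b + A.toEuclideanLin (√h • z)‖ ^ 2) ^ k)
        ∂(stdGaussian (Euc d)) ≤
      ENNReal.ofReal ((1 + stepRate k * (c * h)) * (1 + ‖x‖ ^ 2) ^ k) := by
  set a : ℝ := 1 + ‖x‖ ^ 2 with ha
  have ha0 : 0 < a := by positivity
  set s := c * h with hs
  have hs0 : 0 ≤ s := by positivity
  have hAc := continuous_toEuclideanLin A
  have hw : ‖h • b‖ ≤ s * (1 + ‖x‖) := by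
    rw [norm_smul, Real.norm_of_nonneg hh, hs]
    nlinarith [norm_nonneg b]
  let Y : Euc d → Euc d := fun z => A.toEuclideanLin (√h • z)
  let Q : Euc d → ℝ := fun z => ‖Y z‖ ^ 2 / a
  have hQ : ∀ z, Q z = h / a * ‖A.toEuclideanLin z‖ ^ 2 := by
    intro z
    simp only [Q, Y, map_smul, norm_smul, mul_pow, Real.norm_of_nonneg (Real.sqrt_nonneg h),
      Real.sq_sqrt hh]
    ring
  have hQi : ∀ p : ℕ, 1 ≤ p → Integrable (fun z => Q z ^ p) (stdGaussian (Euc d)) := by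
    intro p hp
    simp_rw [hQ, mul_pow]
    exact (integral_norm_toEuclideanLin_pow_le A hp).1.const_mul _
  have hQm : ∀ p : ℕ, 1 ≤ p →
      ∫ z, Q z ^ p ∂(stdGaussian (Euc d)) ≤ 2 * normalMoment p * s := by
    intro p hp
    simp_rw [hQ, mul_pow]
    rw [integral_const_mul]
    have h1 := (integral_norm_toEuclideanLin_pow_le A hp).2
    have h2 : h / a * ∑ i, ∑ j, A i j ^ 2 ≤ 2 * s := by
      rw [div_mul_eq_mul_div, div_le_iff₀ ha0]
      calc h * ∑ i, ∑ j, A i j ^ 2 ≤ h * (c * (1 + ‖x‖) ^ 2) := by gcongr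
        _ = s * (1 + ‖x‖) ^ 2 := by rw [hs]; ring
        _ ≤ s * (2 * a) := by
          gcongr
          rw [ha]; nlinarith [sq_nonneg (‖x‖ - 1)]
        _ = _ := by ring
    have hS : 0 ≤ ∑ i, ∑ j, A i j ^ 2 := by positivity
    -- Since `2 * s ≤ 1`, all powers of `2 * s` collapse to the first, so every moment of `Q` is of
    -- first order in `s`.
    have h3 : (h / a * ∑ i, ∑ j, A i j ^ 2) ^ p ≤ 2 * s := by
      refine (pow_le_pow_left₀ (by positivity) h2 p).trans ?_
      exact pow_le_of_le_one (by positivity) (by linarith) (by omega)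
    calc _ ≤ (h / a) ^ p * ((∑ i, ∑ j, A i j ^ 2) ^ p * normalMoment p) := by gcongr
      _ = (h / a * ∑ i, ∑ j, A i j ^ 2) ^ p * normalMoment p := by ring
      _ ≤ 2 * s * normalMoment p := by
        have := normalMoment_nonneg p
        gcongr
      _ = _ := by ring
  let L : StrongDual ℝ (Euc d) :=
    (innerSL ℝ (x + h • b)).comp (√h • LinearMap.toContinuousLinearMap A.toEuclideanLin)
  have hL : ∀ z, inner ℝ (x + h • b) (Y z) = L z := by
    intro z; simp [L, Y, inner_smul_right, inner_add_left, inner_smul_left, mul_add]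
  have hLi : Integrable (fun z => L z) (stdGaussian (Euc d)) :=
    L.integrable_comp IsGaussian.integrable_id
  have hL0 : ∫ z, L z ∂(stdGaussian (Euc d)) = 0 := integral_strongDual_stdGaussian L
  have hQ1 := hQi 1 le_rfl
  have hQk := hQi (k + 1) (by omega)
  have hQk2 := hQi (k + 2) (by omega)
  have hm1 := hQm 1 le_rfl
  have hmk := hQm (k + 1) (by omega)
  have hmk2 := hQm (k + 2) (by omega)
  simp only [pow_one] at hQ1 hm1
  let D := remainderConst k
  have hD : 0 ≤ D := by simp only [D, remainderConst]; positivity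
  -- The pointwise bound sorted into a constant, the centred linear term `L` and powers of `Q`, so
  -- that it can be integrated term by term.
  let G : Euc d → ℝ := fun z => a ^ k * ((1 + k * (5 * s) + k ^ 2 * D * s)
      + (k * (2 / a)) * L z + (k + k ^ 2 * D) * Q z + (k ^ 2 * D * s) * Q z ^ (k + 1)
      + (k ^ 2 * D) * Q z ^ (k + 2))
  have hle : ∀ z, (1 + ‖x + h • b + Y z‖ ^ 2) ^ k ≤ G z := by
    intro z
    refine (one_add_norm_sq_pow_le x (h • b) (Y z) hs0 hch hw k).trans (le_of_eq ?_)
    rw [hL z]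
    simp only [G, D, Q]
    ring
  have hG0 : ∀ z, 0 ≤ G z := fun z => le_trans (by positivity) (hle z)
  have e0 : Integrable (fun _ : Euc d => 1 + k * (5 * s) + k ^ 2 * D * s) (stdGaussian (Euc d)) :=
    integrable_const _
  have e1 := hLi.const_mul (k * (2 / a))
  have e2 := hQ1.const_mul (k + k ^ 2 * D)
  have e3 := hQk.const_mul (k ^ 2 * D * s)
  have e4 := hQk2.const_mul (k ^ 2 * D)
  have f1 : Integrable (fun z => (1 + k * (5 * s) + k ^ 2 * D * s) + (k * (2 / a)) * L z)
    (stdGaussian (Euc d)) := e0.add e1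
  have f2 : Integrable (fun z => (1 + k * (5 * s) + k ^ 2 * D * s) + (k * (2 / a)) * L z
    + (k + k ^ 2 * D) * Q z) (stdGaussian (Euc d)) := f1.add e2
  have f3 : Integrable (fun z => (1 + k * (5 * s) + k ^ 2 * D * s) + (k * (2 / a)) * L z
    + (k + k ^ 2 * D) * Q z + (k ^ 2 * D * s) * Q z ^ (k + 1)) (stdGaussian (Euc d)) := f2.add e3
  have hGi : Integrable G (stdGaussian (Euc d)) := (f3.add e4).const_mul (a ^ k)
  have hGv : ∫ z, G z ∂(stdGaussian (Euc d)) = a ^ k * ((1 + k * (5 * s) + k ^ 2 * D * s)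
      + (k * (2 / a)) * 0 + (k + k ^ 2 * D) * ∫ z, Q z ∂(stdGaussian (Euc d))
      + (k ^ 2 * D * s) * ∫ z, Q z ^ (k + 1) ∂(stdGaussian (Euc d))
      + (k ^ 2 * D) * ∫ z, Q z ^ (k + 2) ∂(stdGaussian (Euc d))) := by
    simp only [G]
    rw [integral_const_mul, integral_add f3 e4, integral_add f2 e3, integral_add f1 e2,
      integral_add e0 e1,
      integral_const_mul, integral_const_mul, integral_const_mul, integral_const_mul, hL0]
    simp
  calc _ ≤ ∫⁻ z, ENNReal.ofReal (G z) ∂(stdGaussian (Euc d)) :=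
        lintegral_mono fun z => ENNReal.ofReal_le_ofReal (hle z)
    _ = ENNReal.ofReal (∫ z, G z ∂(stdGaussian (Euc d))) :=
        (ofReal_integral_eq_lintegral_ofReal hGi (by filter_upwards with z using hG0 z)).symm
    _ ≤ _ := by
      refine ENNReal.ofReal_le_ofReal ?_
      rw [hGv, mul_comm (1 + stepRate k * s)]
      refine mul_le_mul_of_nonneg_left ?_ (by positivity)
      have n1 := normalMoment_nonneg (k + 1)
      have t1 := mul_le_mul_of_nonneg_left hm1 (show 0 ≤ (k : ℝ) + k ^ 2 * D by positivity)
      have t2 : (k ^ 2 * D * s) * ∫ z, Q z ^ (k + 1) ∂(stdGaussian (Euc d)) ≤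
          (k ^ 2 * D) * (2 * normalMoment (k + 1) * s) := by
        calc _ ≤ (k ^ 2 * D * s) * (2 * normalMoment (k + 1) * s) := by gcongr
          _ ≤ (k ^ 2 * D * 1) * (2 * normalMoment (k + 1) * s) := by gcongr; linarith
          _ = _ := by ring
      have t3 := mul_le_mul_of_nonneg_left hmk2 (show 0 ≤ (k : ℝ) ^ 2 * D by positivity)
      have : 1 + stepRate k * s = (1 + k * (5 * s) + k ^ 2 * D * s)
        + (k + k ^ 2 * D) * (2 * normalMoment 1 * s)
        + (k ^ 2 * D) * (2 * normalMoment (k + 1) * s)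
        + (k ^ 2 * D) * (2 * normalMoment (k + 2) * s) := by
        simp only [stepRate, D]; ring
      rw [this]
      linarith

/-! ### Growth bounds, and measurability of the scheme on the grid -/

lemma enorm_le_growth_mul {d : ℕ} {F : Type*} [NormedAddCommGroup F] (r : ℝ) (h : Euc d → F)
    (x : Euc d) : ‖h x‖ₑ ≤ growth r h * ENNReal.ofReal ((1 + ‖x‖) ^ r) := by
  have h0 : 0 < (1 + ‖x‖) ^ r := by positivity
  rw [← ENNReal.div_le_iff (by simpa using h0) ENNReal.ofReal_ne_top]
  exact le_iSup (fun x : Euc d => ‖h x‖ₑ / ENNReal.ofReal ((1 + ‖x‖) ^ r)) x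

lemma growth_le_growthTime {d : ℕ} {F : Type*} [NormedAddCommGroup F] {T t : ℝ≥0} (ht : t ≤ T)
    (r : ℝ) (h : ℝ≥0 → Euc d → F) : growth r (h t) ≤ growthTime T r h :=
  le_iSup (fun t : Set.Iic T => growth r (h t)) ⟨t, ht⟩

lemma norm_drift_le {d : ℕ} {T c : ℝ≥0} {μ : ℝ≥0 → Euc d → Euc d}
    {σ : ℝ≥0 → Euc d → Matrix (Fin d) (Fin d) ℝ} (hc : (c : ℝ≥0∞) = coeffGrowth T μ σ)
    {t : ℝ≥0} (ht : t ≤ T) (x : Euc d) : ‖μ t x‖ ≤ c * (1 + ‖x‖) := by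
  have h1 : growth 1 (μ t) ≤ c := by
    rw [hc]; exact (growth_le_growthTime ht 1 μ).trans (le_max_left _ _)
  have h2 : ‖μ t x‖ₑ ≤ c * ENNReal.ofReal ((1 + ‖x‖) ^ (1 : ℝ)) :=
    (enorm_le_growth_mul 1 (μ t) x).trans (by gcongr)
  rw [Real.rpow_one, ← ENNReal.ofReal_coe_nnreal, ← ENNReal.ofReal_mul c.coe_nonneg,
    ← ofReal_norm] at h2
  exact (ENNReal.ofReal_le_ofReal_iff (by positivity)).1 h2

section Frobenius

attribute [local instance] Matrix.frobeniusNormedAddCommGroup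

lemma sum_sq_diffusion_le {d : ℕ} {T c : ℝ≥0} {μ : ℝ≥0 → Euc d → Euc d}
    {σ : ℝ≥0 → Euc d → Matrix (Fin d) (Fin d) ℝ} (hc : (c : ℝ≥0∞) = coeffGrowth T μ σ)
    {t : ℝ≥0} (ht : t ≤ T) (x : Euc d) :
    ∑ i, ∑ j, σ t x i j ^ 2 ≤ c * (1 + ‖x‖) ^ 2 := by
  have h1 : growth 1 (σ t) ^ 2 ≤ c := by
    rw [hc]
    exact (pow_le_pow_left' (growth_le_growthTime ht 1 σ) 2).trans (le_max_right _ _)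
  have h2 : ‖σ t x‖ₑ ^ 2 ≤ c * ENNReal.ofReal ((1 + ‖x‖) ^ (1 : ℝ)) ^ 2 := by
    refine (pow_le_pow_left' (enorm_le_growth_mul 1 (σ t) x) 2).trans ?_
    rw [mul_pow]
    gcongr
  rw [Real.rpow_one, ← ENNReal.ofReal_coe_nnreal, ← ENNReal.ofReal_pow (by positivity),
    ← ENNReal.ofReal_mul c.coe_nonneg, ← ofReal_norm,
    ← ENNReal.ofReal_pow (norm_nonneg _)] at h2
  have h3 := (ENNReal.ofReal_le_ofReal_iff (by positivity)).1 h2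
  refine le_of_eq_of_le ?_ h3
  rw [Matrix.frobenius_norm_def, ← Real.rpow_natCast, ← Real.rpow_mul (by positivity)]
  simp

end Frobenius

lemma MeasurableUpTo.measurable {d : ℕ} {F : Type*} [MeasurableSpace F] {T t : ℝ≥0}
    {h : ℝ≥0 → Euc d → F} (hh : MeasurableUpTo T h) (ht : t ≤ T) : Measurable (h t) :=
  Measurable.comp (g := fun p : Set.Iic T × Euc d => h p.1 p.2) hh
    (f := fun x => ((⟨t, ht⟩ : Set.Iic T), x)) (by fun_prop)

lemma gridPoint_mono (T : ℝ≥0) (N : ℕ) : Monotone (gridPoint T N) := by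
  intro m n hmn
  unfold gridPoint
  gcongr

lemma gridPoint_self (T : ℝ≥0) {N : ℕ} (hN : 1 ≤ N) : gridPoint T N N = T := by
  have : (N : ℝ≥0) ≠ 0 := by exact_mod_cast (by omega : N ≠ 0)
  rw [gridPoint]
  field_simp

lemma gridPoint_le (T : ℝ≥0) {N n : ℕ} (hN : 1 ≤ N) (hn : n ≤ N) : gridPoint T N n ≤ T :=
  (gridPoint_mono T N hn).trans_eq (gridPoint_self T hN)

lemma gridPoint_succ_sub (T : ℝ≥0) (N n : ℕ) :
    (gridPoint T N (n + 1) : ℝ) - gridPoint T N n = T / N := by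
  simp [gridPoint]
  ring

lemma measurable_toEuclideanLin {d : ℕ} {α : Type*} [MeasurableSpace α]
    {A : α → Matrix (Fin d) (Fin d) ℝ} {v : α → Euc d}
    (hA : ∀ i j, Measurable fun a => A a i j) (hv : Measurable v) :
    Measurable fun a => (A a).toEuclideanLin (v a) := by
  refine (WithLp.measurable_toLp 2 (Fin d → ℝ)).comp (g := fun u => WithLp.toLp 2 u)
    (f := fun a => (A a).mulVec (v a).ofLp) ?_
  refine measurable_pi_iff.2 fun i => ?_
  simp only [Matrix.mulVec, dotProduct]
  refine Finset.measurable_sum _ fun j _ => (hA i j).mul ?_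
  fun_prop

lemma measurable_add_smul_add {E α : Type*} [NormedAddCommGroup E] [NormedSpace ℝ E]
    [MeasurableSpace E] [BorelSpace E] [SecondCountableTopology E] [MeasurableSpace α]
    {u v w : α → E} (hu : Measurable u) (hv : Measurable v) (hw : Measurable w) (h : ℝ) :
    Measurable fun a => u a + h • v a + w a := by
  fun_prop

/-- The σ-algebra on `α` is arbitrary and only grid times up to `t_n` enter. Hence the same lemma
yields adaptedness (with `ℱ` at time `t_n`), measurability on `Ω`, and joint measurability in `(ω,
x)`. -/
lemma measurable_eulerGrid {d : ℕ} {α : Type*} [MeasurableSpace α] {T : ℝ≥0} {N : ℕ} (hN : 1 ≤ N)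
    {μ : ℝ≥0 → Euc d → Euc d} (hμ : MeasurableUpTo T μ)
    {σ : ℝ≥0 → Euc d → Matrix (Fin d) (Fin d) ℝ}
    (hσ : ∀ i j, MeasurableUpTo T fun t y => σ t y i j)
    {w : α → ℝ≥0 → Euc d} {x : α → Euc d} (hx : Measurable x) {n : ℕ} (hn : n ≤ N)
    (hw : ∀ i ≤ n, Measurable fun a => w a (gridPoint T N i)) :
    Measurable fun a => eulerGrid T N μ σ (w a) (x a) n := by
  induction n with
  | zero => exact hx
  | succ n ih =>
    have hY := ih (by omega) fun i hi => hw i (by omega)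
    have ht : gridPoint T N n ≤ T := gridPoint_le T hN (by omega)
    have h1 : Measurable fun a => μ (gridPoint T N n) (eulerGrid T N μ σ (w a) (x a) n) :=
      (hμ.measurable ht).comp hY
    have h2 : Measurable fun a => w a (gridPoint T N (n + 1)) - w a (gridPoint T N n) :=
      (hw (n + 1) le_rfl).sub (hw n (by omega))
    have h3 := measurable_toEuclideanLin (fun i j => ((hσ i j).measurable ht).comp hY) h2
    simp only [Function.comp_apply] at h3
    simp only [eulerGrid]
    exact measurable_add_smul_add hY h1 h3 _

lemma eulerGrid_eq_sum {d : ℕ} (T : ℝ≥0) (N : ℕ) (μ : ℝ≥0 → Euc d → Euc d)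
    (σ : ℝ≥0 → Euc d → Matrix (Fin d) (Fin d) ℝ) (w : ℝ≥0 → Euc d) (x : Euc d) (n : ℕ) :
    eulerGrid T N μ σ w x n = x + ∑ i ∈ Finset.range n,
      (((gridPoint T N (i + 1) : ℝ) - gridPoint T N i) •
          μ (gridPoint T N i) (eulerGrid T N μ σ w x i)
      + (σ (gridPoint T N i) (eulerGrid T N μ σ w x i)).toEuclideanLin
          (w (gridPoint T N (i + 1)) - w (gridPoint T N i))) := by
  induction n with
  | zero => simp [eulerGrid]
  | succ n ih =>
    rw [Finset.sum_range_succ, ← add_assoc, ← ih, eulerGrid, add_assoc]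

/-- The summands with index at least `n` vanish, since `min` freezes both of their endpoints at
`t_n`. -/
lemma euler_gridPoint {d : ℕ} (T : ℝ≥0) {N n : ℕ} (hn : n ≤ N) (μ : ℝ≥0 → Euc d → Euc d)
    (σ : ℝ≥0 → Euc d → Matrix (Fin d) (Fin d) ℝ) (w : ℝ≥0 → Euc d) (x : Euc d) :
    euler T N μ σ w x (gridPoint T N n) = eulerGrid T N μ σ w x n := by
  rw [eulerGrid_eq_sum, euler]
  congr 1
  symm
  rw [← Finset.sum_subset (Finset.range_mono hn)]
  · refine Finset.sum_congr rfl fun i hi => ?_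
    have hi := Finset.mem_range.1 hi
    rw [min_eq_right (gridPoint_mono T N (by omega : i + 1 ≤ n)),
      min_eq_right (gridPoint_mono T N (by omega : i ≤ n))]
  · intro i _ hi
    have hi : n ≤ i := by simpa using hi
    rw [min_eq_left (gridPoint_mono T N (by omega : n ≤ i + 1)),
      min_eq_left (gridPoint_mono T N hi)]
    simp

lemma payoff_euler {d o : ℕ} (T : ℝ≥0) {N : ℕ} (hN : 1 ≤ N) (μ : ℝ≥0 → Euc d → Euc d)
    (σ : ℝ≥0 → Euc d → Matrix (Fin d) (Fin d) ℝ) (f : Euc d → Euc o) (g : ℝ≥0 → Euc d → Euc o)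
    (w : ℝ≥0 → Euc d) (x : Euc d) :
    payoff T N f g (euler T N μ σ w x) = f (eulerGrid T N μ σ w x N) + ((T : ℝ) / N) •
      ∑ n ∈ Finset.range N, g (gridPoint T N n) (eulerGrid T N μ σ w x n) := by
  have h1 := euler_gridPoint T (le_refl N) μ σ w x
  rw [gridPoint_self T hN] at h1
  rw [payoff, h1]
  congr 2
  refine Finset.sum_congr rfl fun n hn => ?_
  rw [euler_gridPoint T (Finset.mem_range.1 hn).le]

/-! ### Moments of the Euler scheme and of the payoff -/

/-- The Markov property at the grid points: the state at `t_n` is independent of the next increment,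
so their joint law is a product, and Tonelli reduces the induction step to one Euler step from a
deterministic point. -/
lemma lintegral_eulerGrid_le (k : ℕ) {d : ℕ} {Ω : Type*} {mΩ : MeasurableSpace Ω} {P : Measure Ω}
    [IsProbabilityMeasure P] {ℱ : Filtration ℝ≥0 mΩ} {W : ℝ≥0 → Ω → Euc d} (hW : IsWiener ℱ W P)
    {T : ℝ≥0} {μ : ℝ≥0 → Euc d → Euc d} (hμ : MeasurableUpTo T μ)
    {σ : ℝ≥0 → Euc d → Matrix (Fin d) (Fin d) ℝ}
    (hσ : ∀ i j, MeasurableUpTo T fun t y => σ t y i j) {N : ℕ} (hN : 1 ≤ N) {c : ℝ≥0}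
    (hc : (c : ℝ≥0∞) = coeffGrowth T μ σ) (hcN : 16 * c * T ≤ (N : ℝ≥0)) (x : Euc d) {n : ℕ}
    (hn : n ≤ N) :
    ∫⁻ ω, ENNReal.ofReal ((1 + ‖eulerGrid T N μ σ (fun s => W s ω) x n‖ ^ 2) ^ k) ∂P ≤
      ENNReal.ofReal ((1 + stepRate k * (c * (T / N))) ^ n * (1 + ‖x‖ ^ 2) ^ k) := by
  have hN0 : (0 : ℝ) < N := by exact_mod_cast hN
  have hB := stepRate_nonneg k
  have hch : (c : ℝ) * (T / N) ≤ 1 / 16 := by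
    have : (16 : ℝ) * c * T ≤ N := by exact_mod_cast hcN
    rw [← mul_div_assoc, div_le_iff₀ hN0]
    linarith
  induction n with
  | zero => simp [eulerGrid]
  | succ n ih =>
    set s := gridPoint T N n with hs
    set t := gridPoint T N (n + 1) with ht
    have hst : s ≤ t := gridPoint_mono T N (by omega)
    have hsT : s ≤ T := gridPoint_le T hN (by omega)
    have hdt : (t : ℝ) - s = T / N := gridPoint_succ_sub T N n
    let Y : Ω → Euc d := fun ω => eulerGrid T N μ σ (fun s => W s ω) x n
    let Z : Ω → Euc d := fun ω => W t ω - W s ω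
    have hYm : Measurable[ℱ s] Y :=
      @measurable_eulerGrid d Ω (ℱ s) T N hN μ hμ σ hσ (fun ω s => W s ω) (fun _ => x)
        measurable_const n (by omega)
        fun i hi => (hW.adapted _).mono (ℱ.mono (gridPoint_mono T N hi)) le_rfl
    have hY : Measurable Y := hYm.mono (ℱ.le s) le_rfl
    have hWm : ∀ t, Measurable (W t) := fun t => (hW.adapted t).mono (ℱ.le t) le_rfl
    have hZ : Measurable Z := (hWm t).sub (hWm s)
    have hind : IndepFun Y Z P :=
      (indep_of_indep_of_le_right (hW.indep_increment s t hst) hYm.comap_le).symm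
    have hlaw := (indepFun_iff_map_prod_eq_prod_map_map hY.aemeasurable hZ.aemeasurable).1 hind
    let F : Euc d × Euc d → ℝ≥0∞ := fun p => ENNReal.ofReal
      ((1 + ‖p.1 + ((T : ℝ) / N) • μ s p.1 + (σ s p.1).toEuclideanLin p.2‖ ^ 2) ^ k)
    have hF : Measurable F := by
      have h1 : Measurable fun p : Euc d × Euc d => μ s p.1 :=
        (hμ.measurable hsT).comp measurable_fst
      have h2 : Measurable fun p : Euc d × Euc d => (σ s p.1).toEuclideanLin p.2 :=
        measurable_toEuclideanLin (fun i j => ((hσ i j).measurable hsT).comp measurable_fst)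
          measurable_snd
      have h3 := measurable_add_smul_add measurable_fst h1 h2 ((T : ℝ) / N)
      exact ENNReal.measurable_ofReal.comp (((h3.norm.pow_const 2).const_add 1).pow_const k)
    have hstep : ∀ ω, ENNReal.ofReal
        ((1 + ‖eulerGrid T N μ σ (fun s => W s ω) x (n + 1)‖ ^ 2) ^ k) = F (Y ω, Z ω) := by
      intro ω
      simp only [F, eulerGrid, gridPoint_succ_sub, Y, Z]
      rfl
    simp_rw [hstep]
    rw [← lintegral_map hF (hY.prodMk hZ), hlaw, lintegral_prod _ hF.aemeasurable]
    have hin : ∀ y, ∫⁻ z, F (y, z) ∂(P.map Z) ≤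
        ENNReal.ofReal (1 + stepRate k * (c * (T / N))) * ENNReal.ofReal ((1 + ‖y‖ ^ 2) ^ k) := by
      intro y
      rw [show P.map Z = _ from hW.law_increment s t hst, lintegral_map
        (f := fun z => F (y, z)) (hF.comp measurable_prodMk_left) (by fun_prop), ← ENNReal.ofReal_mul (by positivity), hdt]
      exact lintegral_euler_step_le k y (μ s y) (σ s y) (by positivity) c.coe_nonneg hch
        (norm_drift_le hc hsT y) (sum_sq_diffusion_le hc hsT y)
    refine (lintegral_mono hin).trans ?_
    rw [lintegral_const_mul _ (by fun_prop), lintegral_map (by fun_prop) hY]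
    refine (mul_le_mul_right (ih (by omega)) _).trans ?_
    rw [← ENNReal.ofReal_mul (by positivity), pow_succ']
    exact le_of_eq (by ring_nf)

/-- The moments of the Euler scheme on the grid grow at most exponentially in `c T`. -/
lemma eLpNorm_one_add_norm_eulerGrid_rpow_le {r : ℝ} (hr : 1 ≤ r) {d : ℕ} {Ω : Type*}
    {mΩ : MeasurableSpace Ω} {P : Measure Ω}
    [IsProbabilityMeasure P] {ℱ : Filtration ℝ≥0 mΩ} {W : ℝ≥0 → Ω → Euc d} (hW : IsWiener ℱ W P)
    {T : ℝ≥0} {μ : ℝ≥0 → Euc d → Euc d} (hμ : MeasurableUpTo T μ)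
    {σ : ℝ≥0 → Euc d → Matrix (Fin d) (Fin d) ℝ}
    (hσ : ∀ i j, MeasurableUpTo T fun t y => σ t y i j) {N : ℕ} (hN : 1 ≤ N) {c : ℝ≥0}
    (hc : (c : ℝ≥0∞) = coeffGrowth T μ σ) (hcN : 16 * c * T ≤ (N : ℝ≥0)) (x : Euc d) {n : ℕ}
    (hn : n ≤ N) :
    eLpNorm (fun ω => (1 + ‖eulerGrid T N μ σ (fun s => W s ω) x n‖) ^ r) 2 P ≤
      ENNReal.ofReal (2 ^ (r / 2) * Real.exp (stepRate ⌈r⌉₊ * r * c * T) * (1 + ‖x‖) ^ r) := by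
  set k := ⌈r⌉₊ with hk
  have hk1 : 1 ≤ k := Nat.one_le_iff_ne_zero.2 (by simp [hk]; linarith)
  have hrk : r ≤ k := Nat.le_ceil r
  have hN0 : (0 : ℝ) < N := by exact_mod_cast hN
  have hB := stepRate_nonneg k
  have hWm : ∀ t, Measurable (W t) := fun t => (hW.adapted t).mono (ℱ.le t) le_rfl
  let Y : Ω → Euc d := fun ω => eulerGrid T N μ σ (fun s => W s ω) x n
  have hY : Measurable Y :=
    measurable_eulerGrid hN hμ hσ (w := fun ω s => W s ω) (x := fun _ => x)
        measurable_const hn fun i _ => hWm _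
  let U : Ω → ℝ := fun ω => 1 + ‖Y ω‖ ^ 2
  have hU : Measurable U := by fun_prop
  set e := Real.exp (stepRate k * (c * T)) with he
  have he1 : 1 ≤ e := Real.one_le_exp (by positivity)
  have hgrow : (1 + stepRate k * (c * (T / N))) ^ n ≤ e := by
    have h0 : 0 ≤ stepRate k * (c * (T / N)) := by positivity
    calc (1 + stepRate k * (c * (T / N))) ^ n ≤ (1 + stepRate k * (c * (T / N))) ^ N :=
          pow_le_pow_right₀ (by linarith) hn
      _ ≤ Real.exp (stepRate k * (c * (T / N))) ^ N := by
          refine pow_le_pow_left₀ (by positivity) ?_ N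
          rw [add_comm]; exact Real.add_one_le_exp _
      _ = e := by
          rw [← Real.exp_nat_mul, he]; congr 1; field_simp
  have hUk : eLpNorm U k P ≤ ENNReal.ofReal (e * (1 + ‖x‖ ^ 2)) := by
    have h0 : eLpNorm U k P ^ k = ∫⁻ ω, ENNReal.ofReal (U ω ^ k) ∂P := by
      have := eLpNorm_nnreal_pow_eq_lintegral (μ := P) (f := U) (p := (k : ℝ≥0))
        (by exact_mod_cast (by omega : k ≠ 0))
      simp only [NNReal.coe_natCast, ENNReal.rpow_natCast, ENNReal.coe_natCast] at this
      rw [this]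
      refine lintegral_congr fun ω => ?_
      have : 0 ≤ U ω := by simp only [U]; positivity
      rw [Real.enorm_of_nonneg this, ENNReal.ofReal_pow this]
    rw [← ENNReal.pow_le_pow_left_iff (by omega : k ≠ 0), h0, ← ENNReal.ofReal_pow (by positivity)]
    refine (lintegral_eulerGrid_le k hW hμ hσ hN hc hcN x hn).trans
      (ENNReal.ofReal_le_ofReal ?_)
    rw [mul_pow]
    -- A deliberate loss: it makes the bound a `k`-th power, so that the `k`-th root can be taken
    -- directly.
    have : e ≤ e ^ k := le_self_pow₀ he1 (by omega)
    gcongr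
    exact hgrow.trans this
  have hle : ∀ ω, ‖(1 + ‖Y ω‖) ^ r‖ ≤ 2 ^ (r / 2) * ‖‖U ω‖ ^ (r / 2)‖ := by
    intro ω
    have hU0 : 0 ≤ U ω := by simp only [U]; positivity
    rw [Real.norm_of_nonneg hU0, Real.norm_of_nonneg (by positivity),
      Real.norm_of_nonneg (by positivity), ← Real.mul_rpow (by norm_num) hU0]
    have : (1 + ‖Y ω‖) ^ r = ((1 + ‖Y ω‖) ^ 2) ^ (r / 2) := by
      rw [← Real.rpow_natCast, ← Real.rpow_mul (by positivity)]
      congr 1; push_cast; ring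
    rw [this]
    refine Real.rpow_le_rpow (by positivity) ?_ (by positivity)
    simp only [U]
    nlinarith [sq_nonneg (‖Y ω‖ - 1)]
  refine (eLpNorm_le_mul_eLpNorm_of_ae_le_mul (c := 2 ^ (r / 2))
    (Filter.Eventually.of_forall hle) 2).trans ?_
  rw [eLpNorm_norm_rpow U (by positivity : 0 < r / 2)]
  -- The exponent is `2 * (r / 2) = r ≤ k`, and `L^p` norms increase with `p` on a probability
  -- space.
  have h2 : eLpNorm U (2 * ENNReal.ofReal (r / 2)) P ≤ eLpNorm U k P := by
    refine eLpNorm_le_eLpNorm_of_exponent_le ?_ hU.aestronglyMeasurable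
    rw [show (2 : ℝ≥0∞) = ENNReal.ofReal 2 by simp, ← ENNReal.ofReal_mul (by norm_num),
      mul_div_cancel₀ _ (two_ne_zero), ← ENNReal.ofReal_natCast]
    exact ENNReal.ofReal_le_ofReal hrk
  rw [mul_assoc, ENNReal.ofReal_mul (by positivity)]
  refine mul_le_mul_right ((ENNReal.rpow_le_rpow (h2.trans hUk) (by positivity)).trans ?_) _
  rw [ENNReal.ofReal_rpow_of_nonneg (by positivity) (by positivity)]
  refine ENNReal.ofReal_le_ofReal ?_
  rw [Real.mul_rpow (by positivity) (by positivity)]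
  have h3 : e ^ (r / 2) ≤ Real.exp (stepRate k * r * c * T) := by
    rw [he, ← Real.exp_mul]
    refine Real.exp_le_exp.2 ?_
    have : 0 ≤ stepRate k * r * c * T := by positivity
    linarith
  have h4 : (1 + ‖x‖ ^ 2) ^ (r / 2) ≤ (1 + ‖x‖) ^ r := by
    have : (1 + ‖x‖) ^ r = ((1 + ‖x‖) ^ 2) ^ (r / 2) := by
      rw [← Real.rpow_natCast, ← Real.rpow_mul (by positivity)]
      congr 1; push_cast; ring
    rw [this]
    refine Real.rpow_le_rpow (by positivity) ?_ (by positivity)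
    nlinarith [norm_nonneg x]
  gcongr

/-- Minkowski's inequality: `N` terms of norm at most `B`, each with weight `T / N`, contribute `T *
B`. -/
lemma eLpNorm_add_smul_sum_le {Ω E : Type*} [MeasurableSpace Ω] {P : Measure Ω}
    [NormedAddCommGroup E] [NormedSpace ℝ E] {N : ℕ} (hN : 1 ≤ N) {F : Ω → E} {G : ℕ → Ω → E}
    (hF : AEStronglyMeasurable F P) (hG : ∀ n < N, AEStronglyMeasurable (G n) P) {B : ℝ≥0∞}
    (hFB : eLpNorm F 2 P ≤ B) (hGB : ∀ n < N, eLpNorm (G n) 2 P ≤ B) (T : ℝ≥0) :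
    eLpNorm (fun ω => F ω + ((T : ℝ) / N) • ∑ n ∈ Finset.range N, G n ω) 2 P ≤
      ENNReal.ofReal (1 + T) * B := by
  have hN0 : (0 : ℝ) < N := by exact_mod_cast hN
  have hGm : AEStronglyMeasurable (∑ n ∈ Finset.range N, G n) P :=
    Finset.aestronglyMeasurable_sum _ fun n hn => hG n (Finset.mem_range.1 hn)
  have hsum : eLpNorm (∑ n ∈ Finset.range N, G n) 2 P ≤ N * B := by
    refine (eLpNorm_sum_le (fun n hn => hG n (Finset.mem_range.1 hn)) (by norm_num)).trans
      ((Finset.sum_le_sum fun n hn => hGB n (Finset.mem_range.1 hn)).trans ?_)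
    simp
  have e : (fun ω => F ω + ((T : ℝ) / N) • ∑ n ∈ Finset.range N, G n ω) =
      F + ((T : ℝ) / N) • ∑ n ∈ Finset.range N, G n := by
    ext1 ω
    simp [Finset.sum_apply]
  rw [e]
  refine (eLpNorm_add_le hF (hGm.const_smul _) (by norm_num)).trans ?_
  rw [eLpNorm_const_smul]
  refine (add_le_add hFB (mul_le_mul_right hsum _)).trans (le_of_eq ?_)
  rw [Real.enorm_of_nonneg (by positivity), ← mul_assoc, ← ENNReal.ofReal_natCast,
    ← ENNReal.ofReal_mul (by positivity), div_mul_cancel₀ _ hN0.ne', ← one_add_mul,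
    ENNReal.ofReal_add (by norm_num) T.coe_nonneg, ENNReal.ofReal_one]

lemma eLpNorm_payoff_euler_le {r : ℝ} (hr : 1 ≤ r) {d o : ℕ} {Ω : Type*}
    {mΩ : MeasurableSpace Ω} {P : Measure Ω}
    [IsProbabilityMeasure P] {ℱ : Filtration ℝ≥0 mΩ} {W : ℝ≥0 → Ω → Euc d} (hW : IsWiener ℱ W P)
    {T : ℝ≥0} (hT : 1 ≤ T) {μ : ℝ≥0 → Euc d → Euc d} (hμ : MeasurableUpTo T μ)
    {σ : ℝ≥0 → Euc d → Matrix (Fin d) (Fin d) ℝ}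
    (hσ : ∀ i j, MeasurableUpTo T fun t y => σ t y i j)
    {f : Euc d → Euc o} (hf : Measurable f) {g : ℝ≥0 → Euc d → Euc o} (hg : MeasurableUpTo T g)
    {N : ℕ} (hN : 1 ≤ N) {c : ℝ≥0}
    (hc : (c : ℝ≥0∞) = coeffGrowth T μ σ) (hcN : 16 * c * T ≤ (N : ℝ≥0)) (x : Euc d) :
    eLpNorm (fun ω => payoff T N f g (euler T N μ σ (fun s => W s ω) x)) 2 P ≤
      dataGrowth T r f g * ENNReal.ofReal
        (2 * T * (2 ^ (r / 2) * Real.exp (stepRate ⌈r⌉₊ * r * c * T) * (1 + ‖x‖) ^ r)) := by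
  set D : ℝ := 2 ^ (r / 2) * Real.exp (stepRate ⌈r⌉₊ * r * c * T) * (1 + ‖x‖) ^ r with hD
  have hN0 : (0 : ℝ) < N := by exact_mod_cast hN
  have hWm : ∀ t, Measurable (W t) := fun t => (hW.adapted t).mono (ℱ.le t) le_rfl
  have hY : ∀ n ≤ N, Measurable fun ω => eulerGrid T N μ σ (fun s => W s ω) x n := fun n hn =>
    measurable_eulerGrid hN hμ hσ (w := fun ω s => W s ω) (x := fun _ => x)
        measurable_const hn fun i _ => hWm _
  have hmom : ∀ n ≤ N, ∀ h : Euc d → Euc o, growth r h ≤ dataGrowth T r f g →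
      eLpNorm (fun ω => h (eulerGrid T N μ σ (fun s => W s ω) x n)) 2 P ≤
        dataGrowth T r f g * ENNReal.ofReal D := by
    intro n hn h hh
    refine (eLpNorm_le_mul_eLpNorm_of_ae_le_mul'' (c := dataGrowth T r f g)
      (g := fun ω => (1 + ‖eulerGrid T N μ σ (fun s => W s ω) x n‖) ^ r) 2 ?_ ?_).trans ?_
    · exact ((((hY n hn).norm).const_add 1).pow_const r).aestronglyMeasurable
    · refine Filter.Eventually.of_forall fun ω => (enorm_le_growth_mul r h _).trans ?_
      rw [Real.enorm_of_nonneg (by positivity)]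
      gcongr
    · exact mul_le_mul_right (eLpNorm_one_add_norm_eulerGrid_rpow_le hr hW hμ hσ hN hc hcN x hn) _
  simp_rw [payoff_euler T hN]
  have hfm : Measurable fun ω => f (eulerGrid T N μ σ (fun s => W s ω) x N) :=
    hf.comp (hY N le_rfl)
  have hgm : ∀ n ∈ Finset.range N,
      Measurable fun ω => g (gridPoint T N n) (eulerGrid T N μ σ (fun s => W s ω) x n) := by
    intro n hn
    have hn := (Finset.mem_range.1 hn).le
    exact (hg.measurable (gridPoint_le T hN hn)).comp (hY n hn)
  refine (eLpNorm_add_smul_sum_le hN hfm.aestronglyMeasurable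
    (fun n hn => (hgm n (Finset.mem_range.2 hn)).aestronglyMeasurable)
    (hmom N le_rfl f (le_max_left _ _))
    (fun n hn => hmom n hn.le _ ((growth_le_growthTime (gridPoint_le T hN hn.le) r g).trans
        (le_max_right _ _))) T).trans ?_
  rw [mul_left_comm, ENNReal.ofReal_mul (p := 2 * (T : ℝ)) (by positivity)]
  refine mul_le_mul_right (mul_le_mul_left (ENNReal.ofReal_le_ofReal ?_) _) _
  have : (1 : ℝ) ≤ T := by exact_mod_cast hT
  linarith

/-! ### Payoffs as path functionals, and the Monte Carlo error at a point -/

lemma payoff_congr {d o : ℕ} {T : ℝ≥0} {N : ℕ} (hN : 1 ≤ N) (f : Euc d → Euc o)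
    (g : ℝ≥0 → Euc d → Euc o) {y y' : ℝ≥0 → Euc d} (h : ∀ t ≤ T, y t = y' t) :
    payoff T N f g y = payoff T N f g y' := by
  rw [payoff, payoff, h T le_rfl]
  congr 2
  refine Finset.sum_congr rfl fun n hn => ?_
  rw [h _ (gridPoint_le T hN (Finset.mem_range.1 hn).le)]

/-- The payoff as a functional of a path on `[0,T]`. -/
noncomputable def pathPayoff {d o : ℕ} (T : ℝ≥0) (N : ℕ) (f : Euc d → Euc o)
    (g : ℝ≥0 → Euc d → Euc o) (y : Set.Iic T → Euc d) : Euc o :=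
  payoff T N f g fun t => y ⟨min t T, min_le_right t T⟩

/-- The copies are specified only through their laws as processes on `[0,T]`. This identity lets
equality of laws and independence pass from paths to payoffs. -/
lemma pathPayoff_restrict {d o : ℕ} {T : ℝ≥0} {N : ℕ} (hN : 1 ≤ N) (f : Euc d → Euc o)
    (g : ℝ≥0 → Euc d → Euc o) (y : ℝ≥0 → Euc d) :
    pathPayoff T N f g (fun t : Set.Iic T => y t) = payoff T N f g y :=
  payoff_congr hN f g fun t ht => by simp [min_eq_left ht]

lemma measurable_payoff {d o : ℕ} {α : Type*} [MeasurableSpace α] {T : ℝ≥0} {N : ℕ} (hN : 1 ≤ N)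
    {f : Euc d → Euc o} (hf : Measurable f) {g : ℝ≥0 → Euc d → Euc o} (hg : MeasurableUpTo T g)
    {y : α → ℝ≥0 → Euc d} (hy : ∀ t ≤ T, Measurable fun a => y a t) :
    Measurable fun a => payoff T N f g (y a) := by
  simp only [payoff]
  have h1 : Measurable fun a => f (y a T) := hf.comp (hy T le_rfl)
  have h2 : Measurable fun a => ∑ n ∈ Finset.range N, g (gridPoint T N n) (y a (gridPoint T N n)) :=
    Finset.measurable_sum _ fun n hn =>
      (hg.measurable (gridPoint_le T hN (Finset.mem_range.1 hn).le)).comp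
        (hy _ (gridPoint_le T hN (Finset.mem_range.1 hn).le))
  exact h1.add (h2.fun_const_smul _)

lemma aemeasurable_payoff {d o : ℕ} {α : Type*} [MeasurableSpace α] {m : Measure α} {T : ℝ≥0}
    {N : ℕ} (hN : 1 ≤ N)
    {f : Euc d → Euc o} (hf : Measurable f) {g : ℝ≥0 → Euc d → Euc o} (hg : MeasurableUpTo T g)
    {y : α → ℝ≥0 → Euc d} (hy : ∀ t ≤ T, AEMeasurable (fun a => y a t) m) :
    AEMeasurable (fun a => payoff T N f g (y a)) m := by
  simp only [payoff]
  have h1 : AEMeasurable (fun a => f (y a T)) m := hf.comp_aemeasurable (hy T le_rfl)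
  have h2 : AEMeasurable (fun a => ∑ n ∈ Finset.range N,
      g (gridPoint T N n) (y a (gridPoint T N n))) m :=
    Finset.aemeasurable_fun_sum _ fun n hn =>
      (hg.measurable (gridPoint_le T hN (Finset.mem_range.1 hn).le)).comp_aemeasurable
        (hy _ (gridPoint_le T hN (Finset.mem_range.1 hn).le))
  exact h1.add (h2.fun_const_smul _)

lemma measurable_pathPayoff {d o : ℕ} {T : ℝ≥0} {N : ℕ} (hN : 1 ≤ N)
    {f : Euc d → Euc o} (hf : Measurable f) {g : ℝ≥0 → Euc d → Euc o} (hg : MeasurableUpTo T g) :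
    Measurable (pathPayoff T N f g) :=
  measurable_payoff hN hf hg fun _ _ => measurable_pi_apply _

/-- Variance of a Monte Carlo average of real random variables. -/
lemma lintegral_sq_integral_sub_average_le {Ω : Type*} [MeasurableSpace Ω] {P : Measure Ω}
    [IsProbabilityMeasure P] {M : ℕ} (hM : 1 ≤ M) {Z : Fin M → Ω → ℝ} {Z₀ : Ω → ℝ}
    (hid : ∀ m, IdentDistrib (Z m) Z₀ P P) (hind : iIndepFun Z P) (hZ : MemLp Z₀ 2 P) :
    (M : ℝ≥0∞) * ∫⁻ ω, ‖∫ ω', Z₀ ω' ∂P - 1 / (M : ℝ) * ∑ m, Z m ω‖ₑ ^ 2 ∂P ≤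
      ∫⁻ ω, ‖Z₀ ω‖ₑ ^ 2 ∂P := by
  have hM0 : (0 : ℝ) < M := by exact_mod_cast hM
  have hL : ∀ m, MemLp (Z m) 2 P := fun m => (hid m).memLp_iff.2 hZ
  let A : Ω → ℝ := fun ω => 1 / (M : ℝ) * (∑ m, Z m) ω
  have hA : MemLp A 2 P := (memLp_finsetSum' _ fun m _ => hL m).const_mul _
  have hmean : ∫ ω, A ω ∂P = ∫ ω, Z₀ ω ∂P := by
    simp only [A, Finset.sum_apply]
    rw [integral_const_mul, integral_finsetSum _ fun m _ => (hL m).integrable (by norm_num)]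
    simp_rw [fun m => (hid m).integral_eq]
    simp
    field_simp
  have hvar : Var[A; P] = 1 / M * Var[Z₀; P] := by
    have h1 := IndepFun.variance_sum (s := Finset.univ) (fun m _ => hL m)
      (fun i _ j _ hij => hind.indepFun hij)
    simp only [A]
    rw [variance_const_mul, h1]
    simp_rw [fun m => (hid m).variance_eq]
    simp
    field_simp
  -- The average `A` has mean `E Z₀`, so the mean square error is exactly its variance.
  have hev : ∫⁻ ω, ‖∫ ω', Z₀ ω' ∂P - 1 / (M : ℝ) * ∑ m, Z m ω‖ₑ ^ 2 ∂P = evariance A P := by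
    rw [evariance]
    refine lintegral_congr fun ω => ?_
    rw [hmean, ← enorm_neg, neg_sub]
    simp [A]
  rw [hev, ← hA.ofReal_variance_eq, hvar, ← ENNReal.ofReal_natCast,
    ← ENNReal.ofReal_mul hM0.le, ← mul_assoc, mul_one_div_cancel hM0.ne', one_mul]
  refine (ENNReal.ofReal_le_ofReal (variance_le_expectation_sq hZ.aestronglyMeasurable)).trans ?_
  simp only [Pi.pow_apply]
  rw [ofReal_integral_eq_lintegral_ofReal hZ.integrable_sq
    (Filter.Eventually.of_forall fun ω => sq_nonneg _)]
  refine le_of_eq (lintegral_congr fun ω => ?_)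
  rw [← sq_abs, ENNReal.ofReal_pow (abs_nonneg _), Real.enorm_eq_ofReal_abs]

lemma enorm_sq_eq_sum {o : ℕ} (v : Euc o) : ‖v‖ₑ ^ 2 = ∑ i, ‖v i‖ₑ ^ 2 := by
  rw [← ofReal_norm, ← ENNReal.ofReal_pow (norm_nonneg _), EuclideanSpace.norm_sq_eq,
    ENNReal.ofReal_sum_of_nonneg (fun _ _ => by positivity)]
  refine Finset.sum_congr rfl fun i _ => ?_
  rw [← ofReal_norm, ENNReal.ofReal_pow (norm_nonneg _)]

/-- Mean square error of a Monte Carlo average of random vectors. -/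
lemma lintegral_enorm_integral_sub_average_le {Ω : Type*} [MeasurableSpace Ω] {P : Measure Ω}
    [IsProbabilityMeasure P] {M o : ℕ} (hM : 1 ≤ M) {Z : Fin M → Ω → Euc o} {Z₀ : Ω → Euc o}
    (hid : ∀ m, IdentDistrib (Z m) Z₀ P P) (hind : iIndepFun Z P) (hZ : MemLp Z₀ 2 P) :
    (M : ℝ≥0∞) * ∫⁻ ω, ‖∫ ω', Z₀ ω' ∂P - (1 / (M : ℝ)) • ∑ m, Z m ω‖ₑ ^ 2 ∂P ≤
      ∫⁻ ω, ‖Z₀ ω‖ₑ ^ 2 ∂P := by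
  have hpr : ∀ i : Fin o, Measurable fun v : Euc o => v i := fun i => by fun_prop
  have hZm : ∀ m, AEMeasurable (Z m) P := fun m => (hid m).aemeasurable_fst
  have hint : Integrable Z₀ P := hZ.integrable (by norm_num)
  have hcoord : ∀ i, (∫ ω', Z₀ ω' ∂P) i = ∫ ω', Z₀ ω' i ∂P := fun i =>
    ((EuclideanSpace.proj i : Euc o →L[ℝ] ℝ).integral_comp_comm hint).symm
  -- Squared norms split over coordinates on both sides, so the scalar estimate sums up without a
  -- factor of `o`.
  simp_rw [enorm_sq_eq_sum]
  rw [lintegral_finsetSum' _ fun i _ => by fun_prop, lintegral_finsetSum' _ fun i _ => ?_,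
    Finset.mul_sum]
  · refine Finset.sum_le_sum fun i _ => ?_
    have h := lintegral_sq_integral_sub_average_le hM (Z := fun m ω => Z m ω i)
      (Z₀ := fun ω => Z₀ ω i) (fun m => (hid m).comp (hpr i))
      (hind.comp _ fun m => hpr i) ((EuclideanSpace.proj i : Euc o →L[ℝ] ℝ).comp_memLp' hZ)
    refine le_trans (le_of_eq ?_) h
    congr 1
    refine lintegral_congr fun ω => ?_
    rw [PiLp.sub_apply, hcoord, PiLp.smul_apply, WithLp.ofLp_sum, Finset.sum_apply, smul_eq_mul]
  · have := hZ.aestronglyMeasurable.aemeasurable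
    fun_prop

lemma measurable_payoff_euler {d o : ℕ} {Ω : Type*} [MeasurableSpace Ω] {T : ℝ≥0} {N : ℕ}
    (hN : 1 ≤ N) {μ : ℝ≥0 → Euc d → Euc d} (hμ : MeasurableUpTo T μ)
    {σ : ℝ≥0 → Euc d → Matrix (Fin d) (Fin d) ℝ}
    (hσ : ∀ i j, MeasurableUpTo T fun t y => σ t y i j) {W : ℝ≥0 → Ω → Euc d}
    (hW : ∀ t, Measurable (W t)) {f : Euc d → Euc o} (hf : Measurable f)
    {g : ℝ≥0 → Euc d → Euc o} (hg : MeasurableUpTo T g) :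
    Measurable fun p : Ω × Euc d =>
      payoff T N f g (euler T N μ σ (fun s => W s p.1) p.2) := by
  have hY : ∀ n ≤ N, Measurable fun p : Ω × Euc d =>
      eulerGrid T N μ σ (fun s => W s p.1) p.2 n := fun n hn =>
    measurable_eulerGrid hN hμ hσ (w := fun (p : Ω × Euc d) s => W s p.1) measurable_snd hn
      fun i _ => (hW _).comp measurable_fst
  simp_rw [payoff_euler T hN]
  have h1 : Measurable fun p : Ω × Euc d => f (eulerGrid T N μ σ (fun s => W s p.1) p.2 N) :=
    hf.comp (hY N le_rfl)
  have h2 : Measurable fun p : Ω × Euc d => ∑ n ∈ Finset.range N,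
      g (gridPoint T N n) (eulerGrid T N μ σ (fun s => W s p.1) p.2 n) :=
    Finset.measurable_sum _ fun n hn =>
      (hg.measurable (gridPoint_le T hN (Finset.mem_range.1 hn).le)).comp
        (hY n (Finset.mem_range.1 hn).le)
  exact h1.add (h2.fun_const_smul _)

/-! ### Chebyshev's inequality in `L²(K)` and the final constant -/

lemma one_add_rpow_le {r a : ℝ} (hr : 0 ≤ r) (ha : 0 ≤ a) :
    (1 + a) ^ r ≤ 2 ^ r * (1 + a ^ r) := by
  rcases le_total a 1 with h | h
  · calc (1 + a) ^ r ≤ 2 ^ r := Real.rpow_le_rpow (by positivity) (by linarith) hr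
      _ ≤ _ := le_mul_of_one_le_right (by positivity) (by simp; positivity)
  · calc (1 + a) ^ r ≤ (2 * a) ^ r := Real.rpow_le_rpow (by positivity) (by linarith) hr
      _ = 2 ^ r * a ^ r := Real.mul_rpow (by norm_num) ha
      _ ≤ _ := by gcongr; linarith

lemma eLpNorm_two_sq {α E : Type*} [MeasurableSpace α] [NormedAddCommGroup E] (m : Measure α)
    (u : α → E) : eLpNorm u 2 m ^ 2 = ∫⁻ x, ‖u x‖ₑ ^ 2 ∂m := by
  simpa using eLpNorm_nnreal_pow_eq_lintegral (μ := m) (f := u) (p := 2) (by norm_num)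

/-- Chebyshev's inequality for the `L²` norm of a random field. -/
lemma one_sub_le_measure_eLpNorm_le {Ω α E : Type*} [MeasurableSpace Ω] [MeasurableSpace α]
    [NormedAddCommGroup E] [MeasurableSpace E] [BorelSpace E] {P : Measure Ω}
    [IsProbabilityMeasure P] {ν : Measure α} [SFinite ν] {u : Ω → α → E}
    (hu : AEMeasurable (fun p : Ω × α => u p.1 p.2) (P.prod ν)) {δ ε : ℝ} (hε : 0 < ε)
    (hδ : 0 ≤ δ)
    (h : ∫⁻ x, ∫⁻ ω, ‖u ω x‖ₑ ^ 2 ∂P ∂ν ≤ ENNReal.ofReal (ε ^ 2 * δ)) :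
    ENNReal.ofReal (1 - δ) ≤ P {ω | eLpNorm (u ω) 2 ν ≤ ENNReal.ofReal ε} := by
  have hu2 : AEMeasurable (fun p : Ω × α => ‖u p.1 p.2‖ₑ ^ 2) (P.prod ν) := hu.enorm.pow_const 2
  have hswap : ∫⁻ ω, ∫⁻ x, ‖u ω x‖ₑ ^ 2 ∂ν ∂P ≤ ENNReal.ofReal (ε ^ 2 * δ) := by
    rw [lintegral_lintegral_swap (f := fun ω x => ‖u ω x‖ₑ ^ 2) hu2]
    exact h
  have hε2 : ENNReal.ofReal (ε ^ 2) ≠ 0 := by simp; positivity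
  have hmk := mul_meas_ge_le_lintegral₀ hu2.lintegral_prod_right' (ENNReal.ofReal (ε ^ 2))
  have hbad : P {ω | ENNReal.ofReal (ε ^ 2) ≤ ∫⁻ x, ‖u ω x‖ₑ ^ 2 ∂ν} ≤ ENNReal.ofReal δ := by
    have := hmk.trans hswap
    rw [ENNReal.ofReal_mul (by positivity)] at this
    exact (ENNReal.mul_le_mul_iff_right hε2 ENNReal.ofReal_ne_top).1 this
  -- Covering `Ω` by the good and the bad event, rather than taking a complement, avoids any need
  -- for these events to be measurable.
  have hcov : (Set.univ : Set Ω) ⊆ {ω | eLpNorm (u ω) 2 ν ≤ ENNReal.ofReal ε} ∪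
      {ω | ENNReal.ofReal (ε ^ 2) ≤ ∫⁻ x, ‖u ω x‖ₑ ^ 2 ∂ν} := by
    intro ω _
    rcases le_total (eLpNorm (u ω) 2 ν) (ENNReal.ofReal ε) with h1 | h1
    · exact Or.inl h1
    · right
      simp only [Set.mem_ofPred_eq]
      rw [← eLpNorm_two_sq, ENNReal.ofReal_pow hε.le]
      exact pow_le_pow_left' h1 2
  have h1 : 1 ≤ P {ω | eLpNorm (u ω) 2 ν ≤ ENNReal.ofReal ε} + ENNReal.ofReal δ := by
    rw [← measure_univ (μ := P)]
    exact (measure_mono hcov).trans ((measure_union_le _ _).trans (by gcongr))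
  rw [ENNReal.ofReal_sub 1 hδ, ENNReal.ofReal_one]
  exact tsub_le_iff_right.2 h1

/-- Mean square error of the Monte Carlo Euler method at a fixed starting point. -/
lemma lintegral_enorm_expectedPayoff_sub_mcAverage_le {d o M : ℕ} {Ω : Type*} [MeasurableSpace Ω]
    {P : Measure Ω} [IsProbabilityMeasure P] {T : ℝ≥0} {N : ℕ} (hN : 1 ≤ N) (hM : 1 ≤ M)
    {μ : ℝ≥0 → Euc d → Euc d} {σ : ℝ≥0 → Euc d → Matrix (Fin d) (Fin d) ℝ}
    {W : ℝ≥0 → Ω → Euc d} {f : Euc d → Euc o} (hf : Measurable f) {g : ℝ≥0 → Euc d → Euc o}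
    (hg : MeasurableUpTo T g) {X : Fin M → Euc d → ℝ≥0 → Ω → Euc d}
    (hX : IsIndepEulerCopies P T N μ σ W X) (x : Euc d)
    (hL : MemLp (fun ω => payoff T N f g (euler T N μ σ (fun s => W s ω) x)) 2 P) :
    (M : ℝ≥0∞) * ∫⁻ ω, ‖expectedPayoff P T N μ σ W f g x - mcAverage T N f g X ω x‖ₑ ^ 2 ∂P ≤
      eLpNorm (fun ω => payoff T N f g (euler T N μ σ (fun s => W s ω) x)) 2 P ^ 2 := by
  rw [eLpNorm_two_sq]
  have hm := measurable_pathPayoff hN hf hg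
  refine lintegral_enorm_integral_sub_average_le hM
    (Z := fun m ω => payoff T N f g fun t => X m x t ω) (fun m => ?_) ?_ hL
  · have := (hX.identDistrib m x).comp hm
    have e : ∀ ω, pathPayoff T N f g (fun t : Set.Iic T => X m x t ω) =
        payoff T N f g fun t => X m x t ω := fun ω => pathPayoff_restrict hN f g fun t => X m x t ω
    simpa only [Function.comp_def, pathPayoff_restrict hN, e] using this
  · have := (hX.indep x).comp (fun _ => pathPayoff T N f g) fun _ => hm
    have e : ∀ m ω, pathPayoff T N f g (fun t : Set.Iic T => X m x t ω) =
        payoff T N f g fun t => X m x t ω := fun m ω => pathPayoff_restrict hN f g fun t => X m x t ω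
    simpa only [Function.comp_def, e] using this

/-- The expectation is measurable in `x` as a parameter integral of a jointly measurable function;
the average is only almost everywhere measurable, and restriction to `K` keeps null sets null. -/
lemma aemeasurable_expectedPayoff_sub_mcAverage {d o M : ℕ} {Ω : Type*} [MeasurableSpace Ω]
    {P : Measure Ω} [IsProbabilityMeasure P] {T : ℝ≥0} {N : ℕ} (hN : 1 ≤ N)
    {μ : ℝ≥0 → Euc d → Euc d} (hμ : MeasurableUpTo T μ)
    {σ : ℝ≥0 → Euc d → Matrix (Fin d) (Fin d) ℝ}
    (hσ : ∀ i j, MeasurableUpTo T fun t y => σ t y i j)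
    {W : ℝ≥0 → Ω → Euc d} (hW : ∀ t, Measurable (W t)) {f : Euc d → Euc o} (hf : Measurable f)
    {g : ℝ≥0 → Euc d → Euc o} (hg : MeasurableUpTo T g) {X : Fin M → Euc d → ℝ≥0 → Ω → Euc d}
    (hX : IsIndepEulerCopies P T N μ σ W X) (K : Set (Euc d)) :
    AEMeasurable (fun p : Ω × Euc d =>
      expectedPayoff P T N μ σ W f g p.2 - mcAverage T N f g X p.1 p.2)
      (P.prod (volume.restrict K)) := by
  have hv : Measurable (expectedPayoff P T N μ σ W f g) :=
    ((measurable_payoff_euler hN hμ hσ hW hf hg).stronglyMeasurable.integral_prod_left').measurable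
  have hac : P.prod (volume.restrict K) ≪ P.prod (volume : Measure (Euc d)) :=
    Measure.AbsolutelyContinuous.rfl.prod Measure.restrict_le_self.absolutelyContinuous
  have hφ : AEMeasurable (fun p : Ω × Euc d => mcAverage T N f g X p.1 p.2)
      (P.prod (volume.restrict K)) := by
    have h1 : ∀ m, AEMeasurable (fun p : Ω × Euc d => payoff T N f g fun t => X m p.2 t p.1)
        (P.prod (volume.restrict K)) := fun m =>
      (aemeasurable_payoff hN hf hg (y := fun p : Ω × Euc d => fun t => X m p.2 t p.1)
        (hX.jointly_measurable m)).mono_ac hac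
    simp only [mcAverage]
    exact (Finset.aemeasurable_fun_sum _ fun m _ => h1 m).fun_const_smul _
  exact (hv.comp measurable_snd).aemeasurable.sub hφ

/-- The constant of the Monte Carlo Euler method for data of growth order `r`. -/
noncomputable def mcConst (r : ℝ) : ℝ := 2 * (2 ^ (r / 2) * 2 ^ r) + stepRate ⌈r⌉₊ * r

lemma mcConst_pos {r : ℝ} (hr : 0 ≤ r) : 0 < mcConst r := by
  have := stepRate_nonneg ⌈r⌉₊
  rw [mcConst]
  positivity

/-- `mcConst` is the sum of the prefactor and the exponential rate, so it dominates each and can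
serve in both places. The moment bound itself only needs the factor `T`, which is at most the square
root because `T ≥ 1`. -/
lemma payoff_bound_le {r : ℝ} (hr : 0 ≤ r) {c T : ℝ} (hc : 0 ≤ c) (hT : 1 ≤ T) {a : ℝ}
    (ha : 0 ≤ a) :
    2 * T * (2 ^ (r / 2) * Real.exp (stepRate ⌈r⌉₊ * r * c * T) * (1 + a) ^ r) ≤
      mcConst r * (√((1 + c) * T ^ 3) * Real.exp (mcConst r * c * T)) * (1 + a ^ r) := by
  have hB := stepRate_nonneg ⌈r⌉₊
  have h0 := one_add_rpow_le hr ha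
  have h1 : T ≤ √((1 + c) * T ^ 3) := by
    refine Real.le_sqrt_of_sq_le ?_
    nlinarith [pow_le_pow_right₀ hT (show 2 ≤ 3 by norm_num),
      mul_nonneg hc (show 0 ≤ T ^ 3 by positivity)]
  have h2 : Real.exp (stepRate ⌈r⌉₊ * r * c * T) ≤ Real.exp (mcConst r * c * T) := by
    refine Real.exp_le_exp.2 ?_
    gcongr
    rw [mcConst]
    exact le_add_of_nonneg_left (by positivity)
  have h3 : 2 * (2 ^ (r / 2) * 2 ^ r) ≤ mcConst r := by
    rw [mcConst]
    exact le_add_of_nonneg_right (by positivity)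
  calc _ ≤ 2 * T * (2 ^ (r / 2) * Real.exp (stepRate ⌈r⌉₊ * r * c * T) *
        (2 ^ r * (1 + a ^ r))) := by gcongr
    _ = 2 * (2 ^ (r / 2) * 2 ^ r) * (T * Real.exp (stepRate ⌈r⌉₊ * r * c * T)) * (1 + a ^ r) := by
        ring
    _ ≤ _ := by
        have := mcConst_pos hr
        gcongr

end MCEuler

theorem mainTheorem6 (r : ℝ) (hr : 1 ≤ r) :
    ∃ κ : ℝ, 0 < κ ∧
      ∀ (d o : ℕ) (Ω : Type*) (mΩ : MeasurableSpace Ω) (P : Measure Ω)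
        (_ : IsProbabilityMeasure P) (ℱ : Filtration ℝ≥0 mΩ) (W : ℝ≥0 → Ω → Euc d)
        (_ : MCEuler.IsWiener ℱ W P)
        (T : ℝ≥0) (_ : 1 ≤ T)
        (μ : ℝ≥0 → Euc d → Euc d) (_ : MCEuler.MeasurableUpTo T μ)
        (σ : ℝ≥0 → Euc d → Matrix (Fin d) (Fin d) ℝ) (_ : ∀ i j, MCEuler.MeasurableUpTo T fun t y => σ t y i j)
        (f : Euc d → Euc o) (_ : Measurable f)
        (g : ℝ≥0 → Euc d → Euc o) (_ : MCEuler.MeasurableUpTo T g)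
        (N M : ℕ) (_ : 1 ≤ N) (_ : 1 ≤ M)
        (X : Fin M → Euc d → ℝ≥0 → Ω → Euc d)
        (_ : MCEuler.IsIndepEulerCopies P T N μ σ W X)
        (δ ε : ℝ) (_ : δ ∈ Set.Ioo (0 : ℝ) 1) (_ : ε ∈ Set.Ioo (0 : ℝ) 1)
        (K : Set (Euc d)) (_ : IsCompact K)
        (c : ℝ≥0) (_ : (c : ℝ≥0∞) = MCEuler.coeffGrowth T μ σ)
        (_ : 16 * c * T ≤ (N : ℝ≥0))
        (_ : ENNReal.ofReal κ * MCEuler.dataGrowth T r f g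
              * ENNReal.ofReal (Real.sqrt ((1 + c) * T ^ 3) * Real.exp (κ * c * T))
              * eLpNorm (fun x : Euc d => 1 + ‖x‖ ^ r) 2 (volume.restrict K)
            ≤ ENNReal.ofReal (ε * Real.sqrt (δ * M))),
        (∀ᵐ x ∂(volume.restrict K), Integrable
            (fun ω => MCEuler.payoff T N f g (MCEuler.euler T N μ σ (fun s => W s ω) x)) P) ∧
        ENNReal.ofReal (1 - δ) ≤
          P {ω | eLpNorm (fun x => MCEuler.expectedPayoff P T N μ σ W f g x
                - MCEuler.mcAverage T N f g X ω x) 2 (volume.restrict K)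
              ≤ ENNReal.ofReal ε} := by
  refine ⟨MCEuler.mcConst r, MCEuler.mcConst_pos (by linarith), ?_⟩
  intro d o Ω mΩ P hP ℱ W hW T hT μ hμ σ hσ f hf g hg N M hN hM X hX δ ε hδ hε K hK c hc hcN hle
  have hT' : (1 : ℝ) ≤ T := by exact_mod_cast hT
  have hκ := MCEuler.mcConst_pos (r := r) (by linarith)
  have hWm : ∀ t, Measurable (W t) := fun t => (hW.adapted t).mono (ℱ.le t) le_rfl
  set ν := (volume : Measure (Euc d)).restrict K with hν
  set κ := MCEuler.mcConst r with hκd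
  set C := MCEuler.dataGrowth T r f g with hC
  set A : ℝ := √((1 + c) * T ^ 3) * Real.exp (κ * c * T) with hA
  have hA0 : 0 < A := by positivity
  set η := eLpNorm (fun x : Euc d => 1 + ‖x‖ ^ r) 2 ν with hη
  have hpm : Measurable fun x : Euc d => 1 + ‖x‖ ^ r := by fun_prop
  -- If `C = ∞`, the finite right-hand side of the hypothesis forces `η = 0`; as `1 + ‖x‖ ^ r` is
  -- positive, `K` is a null set and both claims are trivial.
  by_cases hCtop : C = ⊤
  · have hη0 : η = 0 := by
      by_contra hne
      rw [hCtop, ENNReal.mul_top (by simpa using hκ), ENNReal.top_mul (by simpa using hA0),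
        ENNReal.top_mul hne] at hle
      exact absurd hle (by simp)
    rw [hη, eLpNorm_eq_zero_iff hpm.aestronglyMeasurable (by norm_num)] at hη0
    have hν0 : ν = 0 := by
      rw [← ae_eq_bot, ← Filter.eventually_false_iff_eq_bot]
      filter_upwards [hη0] with x hx
      have : 0 < 1 + ‖x‖ ^ r := by positivity
      exact this.ne' hx
    rw [hν0]
    refine ⟨by simp, ?_⟩
    simp only [eLpNorm_measure_zero, zero_le, Set.ofPred_true, measure_univ]
    rw [← ENNReal.ofReal_one]
    exact ENNReal.ofReal_le_ofReal (by linarith [hδ.1])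
  have hbound : ∀ x, eLpNorm (fun ω => MCEuler.payoff T N f g
      (MCEuler.euler T N μ σ (fun s => W s ω) x)) 2 P ≤
      ENNReal.ofReal κ * C * ENNReal.ofReal A * ‖1 + ‖x‖ ^ r‖ₑ := by
    intro x
    refine (MCEuler.eLpNorm_payoff_euler_le hr hW hT hμ hσ hf hg hN hc hcN x).trans ?_
    refine (mul_le_mul_right (ENNReal.ofReal_le_ofReal (MCEuler.payoff_bound_le (by linarith)
      c.coe_nonneg hT' (norm_nonneg x))) _).trans (le_of_eq ?_)
    rw [Real.enorm_of_nonneg (by positivity), ENNReal.ofReal_mul (by positivity),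
      ENNReal.ofReal_mul hκ.le]
    ring
  have hpay : ∀ x, Measurable fun ω =>
      MCEuler.payoff T N f g (MCEuler.euler T N μ σ (fun s => W s ω) x) := fun x =>
    (MCEuler.measurable_payoff_euler hN hμ hσ hWm hf hg).comp
      (measurable_id.prodMk measurable_const)
  have hmem : ∀ x, MemLp (fun ω =>
      MCEuler.payoff T N f g (MCEuler.euler T N μ σ (fun s => W s ω) x)) 2 P := fun x =>
    ⟨(hpay x).aestronglyMeasurable, (hbound x).trans_lt (by finiteness)⟩
  refine ⟨Filter.Eventually.of_forall fun x => (hmem x).integrable (by norm_num), ?_⟩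
  refine MCEuler.one_sub_le_measure_eLpNorm_le
    (u := fun ω x => MCEuler.expectedPayoff P T N μ σ W f g x - MCEuler.mcAverage T N f g X ω x)
    (MCEuler.aemeasurable_expectedPayoff_sub_mcAverage hN hμ hσ hWm hf hg hX K) hε.1 hδ.1.le ?_
  have hM0 : (M : ℝ≥0∞) ≠ 0 := by exact_mod_cast (by omega : M ≠ 0)
  -- After multiplication by `M`, the bound needed for Chebyshev is the square of the hypothesis
  -- `hle`, whose right-hand side becomes `M * ε ^ 2 * δ`.
  rw [← ENNReal.mul_le_mul_iff_right hM0 (ENNReal.natCast_ne_top M),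
    ← lintegral_const_mul' _ _ (ENNReal.natCast_ne_top M)]
  calc ∫⁻ x, M * ∫⁻ ω, ‖MCEuler.expectedPayoff P T N μ σ W f g x
          - MCEuler.mcAverage T N f g X ω x‖ₑ ^ 2 ∂P ∂ν
      ≤ ∫⁻ x, (ENNReal.ofReal κ * C * ENNReal.ofReal A) ^ 2 * ‖1 + ‖x‖ ^ r‖ₑ ^ 2 ∂ν := by
        refine lintegral_mono fun x => ?_
        rw [← mul_pow]
        exact (MCEuler.lintegral_enorm_expectedPayoff_sub_mcAverage_le hN hM hf hg hX x
          (hmem x)).trans (pow_le_pow_left' (hbound x) 2)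
    _ = (ENNReal.ofReal κ * C * ENNReal.ofReal A * η) ^ 2 := by
        rw [lintegral_const_mul _ (by fun_prop), ← MCEuler.eLpNorm_two_sq, mul_pow _ η]
    _ ≤ ENNReal.ofReal (ε * √(δ * M)) ^ 2 := pow_le_pow_left' hle 2
    _ = M * ENNReal.ofReal (ε ^ 2 * δ) := by
        rw [← ENNReal.ofReal_pow (mul_nonneg hε.1.le (Real.sqrt_nonneg _)), mul_pow,
          Real.sq_sqrt (mul_nonneg hδ.1.le (by positivity)), ← ENNReal.ofReal_natCast,
          ← ENNReal.ofReal_mul (by positivity)]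
        congr 1
        ring
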